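/- Fix a finite universal set $G$ of quantum gates containing the identity and the NOT gate. Circuits are circuits over $G$ with input qubits and possibly ancilla qubits (initially $|0\rangle$); their size is the number of gates. A family $\{C_n\}$ of circuits is $\mathbf{P}$-uniform if a deterministic Turing machine outputs a description of $C_n$ on input $1^n$ in time polynomial in $n$. $\mathrm{Prob}[C(\psi)=1]$ is the probability that measuring the output (first) qubit of $C$ on input $\psi$ gives $1$, and $\|X\|_{\mathrm{tr}}=\frac12\mathrm{Tr}\sqrt{X^\dagger X}$. A qustring of length $n$ is a unit vector of $(\mathbb{C}^2)^{\otimes n}$. A qustring $|\phi\rangle$ of length $n$ is $k$-separable if for some permutation $\sigma$ of $\{1,\dots,n\}$ the state $\sigma(|\phi\rangle)$ obtained by permuting its qubits by $\sigma$ equals $|\phi_1\rangle\otimes\cdots\otimes|\phi_k\rangle$ with qustrings $|\phi_i\rangle$ of lengths $m_i\ge 1$; then $\sigma$ is said to achieve the $k$-separability of $|\phi\rangle$ with the $k$-sectioning $\vec m=(m_1,\dots,m_k)$. The separability index of $|\phi\rangle$ is the largest $k$ such that $|\phi\rangle$ is $k$-separable; $|\phi\rangle$ is partially entangled if its index is at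 most $n-1$. An entanglement ensemble of size factor $n$ is a sequence $\Xi=\{|\xi_n\rangle\}_{n}$ of qustrings $|\xi_n\rangle$ of length $n$ that are partially entangled for all $n\ge2$. Let $1^{\vec m}=1^{m_1}0\cdots1^{m_k}0$, $1^{\sigma}=1^{\sigma(1)}0\cdots1^{\sigma(n)}0$ and $1^{\sigma,\vec m}=1^{\sigma}0\,1^{\vec m}0$, a string of length $n^2/2+5n/2+k+2$. For $k:\mathbb{N}\to\mathbb{N}$, $\epsilon:\mathbb{N}\to[0,1]$ and $s:\mathbb{N}\to\mathbb{N}$, $\Xi$ is uniformly $(k,\epsilon,s)$-distinguishable from separable states if there is a $\mathbf{P}$-uniform family of circuits $D_n$ with $n^2/2+7n/2+k(n)+2$ input qubits, of size at most $s(n)$, such that for all but finitely many $n$ $$\bigl|\mathrm{Prob}[D_n(|1^{\sigma,\vec m}\rangle|\xi_n\rangle)=1]-\mathrm{Prob}[D_n(|1^{\sigma,\vec m}\rangle|\phi\rangle)=1]\bigr|\ge\epsilon(n)$$ for every $k(n)$-separable qustring $|\phi\rangle$ of length $n$ and every permutation $\sigma$ achieving its $k(n)$-separability with $k(n)$-sectioning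 $\vec m$. $\Xi$ is uniformly $(\epsilon,s)$-approximable if there is a $\mathbf{P}$-uniform family of circuits $C_n$ with $n$ input qubits and $p(n)\ge0$ ancilla qubits, of size at most $s(n)$, such that for all but finitely many $n$ $$\bigl\|\mathrm{Tr}_{\mathcal{H}_n}\bigl(C_n|0^{p(n)+n}\rangle\langle0^{p(n)+n}|C_n^\dagger\bigr)-|\xi_n\rangle\langle\xi_n|\bigr\|_{\mathrm{tr}}\le\epsilon(n),$$ where $\mathrm{Tr}_{\mathcal{H}_n}$ is the partial trace over the ancilla qubits. Proposition. There exists an entanglement ensemble $\Xi$ of size factor $n$ that is uniformly $(n,1/\sqrt2,s)$-distinguishable from separable states for some $s(n)\in n^{O(1)}$, but is not uniformly $(1/\sqrt2,s)$-approximable for any $s(n)\in n^{O(1)}$. -/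

import Mathlib

noncomputable section

namespace QEnt

/-! ### Qustrings -/

/-- The Hilbert space of `w` qubits; the standard basis is indexed by bit strings
`Fin w → Bool`. -/
abbrev State (w : ℕ) : Type := EuclideanSpace ℂ (Fin w → Bool)

/-- The standard basis vector `|x⟩`. -/
def ket {w : ℕ} (x : Fin w → Bool) : State w := EuclideanSpace.single x 1

/-- The tensor product `ψ ⊗ η`; the qubits of `ψ` come first. -/
def tens {a b : ℕ} (ψ : State a) (η : State b) : State (a + b) :=
  WithLp.toLp 2 fun x => ψ (fun i => x (Fin.castAdd b i)) * η (fun j => x (Fin.natAdd a j))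

/-- A qustring of length `n`: a pure state of `n` qubits. -/
abbrev Qustring (n : ℕ) : Type := {ψ : State n // ‖ψ‖ = 1}

/-- `σ(φ) = ∑ₓ αₓ |x_{σ(1)} x_{σ(2)} ⋯ x_{σ(n)}⟩` for `φ = ∑ₓ αₓ |x₁ x₂ ⋯ xₙ⟩`: the amplitude
of `σ(φ)` at the string `y = x ∘ σ` is `αₓ`. -/
def permute {n : ℕ} (σ : Equiv.Perm (Fin n)) (φ : State n) : State n :=
  WithLp.toLp 2 fun y => φ (fun i => y (σ⁻¹ i))

/-! ### Separability -/

/-- `σ(φ) = φ₁ ⊗ ⋯ ⊗ φₖ` for some qustrings `φᵢ` whose lengths are the blocks `m₁, …, mₖ ≥ 1` of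
the composition `m` of `n`.  That is, `σ` achieves the `k`-separability of `φ` with the
`k`-sectioning `m`, where `k = m.length`. -/
def Achieves {n : ℕ} (σ : Equiv.Perm (Fin n)) (m : Composition n) (φ : State n) : Prop :=
  ∃ ψ : ∀ i : Fin m.length, Qustring (m.blocksFun i),
    ∀ x : Fin n → Bool, permute σ φ x = ∏ i, (ψ i).1 (fun j => x (m.embedding i j))

/-- `φ` is `k`-separable. -/
def IsSeparable {n : ℕ} (k : ℕ) (φ : Qustring n) : Prop :=
  ∃ (σ : Equiv.Perm (Fin n)) (m : Composition n), m.length = k ∧ Achieves σ m φ.1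

/-- The separability index: the largest `k` with `1 ≤ k ≤ n` such that `φ` is `k`-separable. -/
def sind {n : ℕ} (φ : Qustring n) : ℕ := sSup {k | 1 ≤ k ∧ k ≤ n ∧ IsSeparable k φ}

/-- Partially entangled: the separability index is at most `n - 1`. -/
def PartiallyEntangled {n : ℕ} (φ : Qustring n) : Prop := sind φ + 1 ≤ n

/-- An entanglement ensemble with size factor `ℓ`.  No qustring of length `0` or `1` is partially
entangled, so partial entanglement is demanded at every index `n` with `ℓ n ≥ 2`. -/
def IsEntanglementEnsemble (ℓ : ℕ → ℕ) (Ξ : ∀ n, Qustring (ℓ n)) : Prop :=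
  StrictMono ℓ ∧ ∀ n, 2 ≤ ℓ n → PartiallyEntangled (Ξ n)

/-! ### Quantum circuits -/

/-- A finite set of quantum gates: gate `i` is a unitary operator on `arity i` qubits. -/
structure GateSet where
  numGates : ℕ
  arity : Fin numGates → ℕ
  op : ∀ i, Matrix.unitaryGroup (Fin (arity i) → Bool) ℂ

/-- A gate of `G` together with the distinct wires, out of `w`, that it acts on. -/
structure PlacedGate (G : GateSet) (w : ℕ) where
  gate : Fin G.numGates
  wires : Fin (G.arity gate) ↪ Fin w

/-- The action of a placed gate: `(Uψ)(x) = ∑_b U(x|wires, b) ψ(x with the bits on wires set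
to b)`. -/
def PlacedGate.apply {G : GateSet} {w : ℕ} (g : PlacedGate G w) (ψ : State w) : State w :=
  WithLp.toLp 2 fun x =>
    ∑ b : Fin (G.arity g.gate) → Bool,
      (G.op g.gate).1 (fun j => x (g.wires j)) b * ψ (Function.extend g.wires b x)

/-- A quantum circuit over `G` with `a` input qubits, followed by some ancilla qubits.  The gates
are applied in the order of the list. -/
structure Circuit (G : GateSet) (a : ℕ) where
  ancillas : ℕ
  gates : List (PlacedGate G (a + ancillas))

namespace Circuit

variable {G : GateSet} {a : ℕ}

/-- The size of a circuit is its number of gates. -/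
def size (C : Circuit G a) : ℕ := C.gates.length

/-- The final state of the circuit on input `ψ`, all ancilla qubits being `|0⟩` initially. -/
def run (C : Circuit G a) (ψ : State a) : State (a + C.ancillas) :=
  C.gates.foldl (fun φ g => g.apply φ) (tens ψ (ket fun _ => false))

/-- `Prob[C(ψ) = 1]`: the probability that measuring the first qubit, which is the output qubit,
gives `1`. -/
def acceptProb (C : Circuit G a) (ψ : State a) : ℝ := by
  classical
  exact ∑ x : Fin (a + C.ancillas) → Bool,
    if ∃ h : 0 < a + C.ancillas, x ⟨0, h⟩ = true then ‖C.run ψ x‖ ^ 2 else 0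

end Circuit

/-- The string `1ᵐ0`. -/
def unary (m : ℕ) : List Bool := List.replicate m true ++ [false]

/-- The description of a placed gate: the gate's number and then its wires, all as `1ᵐ0`. -/
def PlacedGate.encode {G : GateSet} {w : ℕ} (g : PlacedGate G w) : List Bool :=
  unary g.gate ++ (List.ofFn fun j => unary (g.wires j)).flatten

/-- The description of a circuit: the number of ancilla qubits as `1ᵖ0`, and then the descriptions
of the gates. -/
def Circuit.encode {G : GateSet} {a : ℕ} (C : Circuit G a) : List Bool :=
  unary C.ancillas ++ (C.gates.map PlacedGate.encode).flatten

/-- Every unitary operator on any number of qubits is approximated to any accuracy, by a circuit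
over `G` which may use ancilla qubits (left in a state, global phase included, that does not
depend on the input). -/
def GateSet.Universal (G : GateSet) : Prop :=
  ∀ (m : ℕ) (U : Matrix.unitaryGroup (Fin m → Bool) ℂ) (δ : ℝ), 0 < δ →
    ∃ (C : Circuit G m) (η : State C.ancillas), ‖η‖ = 1 ∧
      ∀ ψ : State m, ‖ψ‖ = 1 → ‖C.run ψ - tens (Matrix.toEuclideanLin U.1 ψ) η‖ ≤ δ

/-- The gate set contains the one-qubit identity gate. -/
def GateSet.HasIdentity (G : GateSet) : Prop :=
  ∃ i, G.arity i = 1 ∧ ∀ x y, (G.op i).1 x y = if x = y then 1 else 0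

/-- The gate set contains the one-qubit NOT gate. -/
def GateSet.HasNot (G : GateSet) : Prop :=
  ∃ i, G.arity i = 1 ∧ ∀ x y, (G.op i).1 x y = if x = (fun j => !(y j)) then 1 else 0

/-- A family of circuits `Cₙ` is `P`-uniform: some deterministic Turing machine computes the
description of `Cₙ` from the input `1ⁿ` in time polynomial in `n`. -/
def PUniform {G : GateSet} {a : ℕ → ℕ} (C : ∀ n, Circuit G (a n)) : Prop :=
  Nonempty (Turing.TM2ComputableInPolyTime
    (fun n : ℕ => List.replicate n true) (id : List Bool → List Bool) (fun n => (C n).encode))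

/-! ### Distinguishability from separable states -/

/-- The string `1^{σ,m} = 1^σ 0 1^m 0`, where `1^σ = 1^{σ(1)}0 ⋯ 1^{σ(n)}0` with values
`σ(i) ∈ {1, …, n}`, and `1^m = 1^{m₁}0 ⋯ 1^{mₖ}0`. -/
def code {n : ℕ} (σ : Equiv.Perm (Fin n)) (m : Composition n) : List Bool :=
  (List.ofFn fun i => unary ((σ i : ℕ) + 1)).flatten ++ [false] ++
    (m.blocks.map unary).flatten ++ [false]

/-- The number `n²/2 + 5n/2 + k + 2`. -/
def codeLength (n k : ℕ) : ℕ := (n ^ 2 + 5 * n) / 2 + k + 2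

theorem length_code {n : ℕ} (σ : Equiv.Perm (Fin n)) (m : Composition n) :
    (code σ m).length = codeLength n m.length := by
  have h1 : ∀ l : List ℕ, ((l.map unary).flatten).length = l.sum + l.length := by
    intro l
    induction l with
    | nil => rfl
    | cons a l ih => simp [unary, ih]; omega
  have h2 : ((List.ofFn fun i => unary ((σ i : ℕ) + 1)).flatten).length
      = ∑ i : Fin n, ((σ i : ℕ) + 1) + n := by
    have : (List.ofFn fun i => unary ((σ i : ℕ) + 1))
        = (List.ofFn fun i => ((σ i : ℕ) + 1)).map unary := by
      simp [List.map_ofFn, Function.comp_def]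
    rw [this, h1]
    simp [List.sum_ofFn]
  have h3 : ∑ i : Fin n, ((σ i : ℕ) + 1) = ∑ i ∈ Finset.range n, (i + 1) := by
    rw [Equiv.sum_comp σ (fun i : Fin n => (i : ℕ) + 1), Finset.sum_range]
  have h4 : (∑ i ∈ Finset.range n, (i + 1)) * 2 = n ^ 2 + n := by
    rw [Finset.sum_add_distrib, add_mul, Finset.sum_range_id_mul_two]
    cases n with
    | zero => rfl
    | succ n => simp; ring
  have h5 : m.blocks.sum = n := m.blocks_sum
  have h6 : m.blocks.length = m.length := rfl
  simp only [code, List.length_append, List.length_singleton, h2, h3, h1, h5, h6, codeLength]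
  omega

/-- The state `|1^{σ,m}⟩|φ⟩`. -/
def codedInput {n : ℕ} (k : ℕ) (σ : Equiv.Perm (Fin n)) (m : Composition n) (φ : Qustring n) :
    State (codeLength n k + n) :=
  tens (ket fun i => (code σ m).getD i false) φ.1

/-- The circuits `Dₙ`, with `ℓ(n)²/2 + 7ℓ(n)/2 + k(n) + 2` input qubits, form an entanglement
`(k, ε)`-distinguisher of `Ξ`. -/
def IsDistinguisher {G : GateSet} {ℓ : ℕ → ℕ} (k : ℕ → ℕ) (ε : ℕ → ℝ)
    (Ξ : ∀ n, Qustring (ℓ n)) (D : ∀ n, Circuit G (codeLength (ℓ n) (k n) + ℓ n)) : Prop :=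
  ∀ᶠ n in Filter.atTop, ∀ (φ : Qustring (ℓ n)) (σ : Equiv.Perm (Fin (ℓ n)))
    (m : Composition (ℓ n)), m.length = k n → Achieves σ m φ.1 →
      ε n ≤ |(D n).acceptProb (codedInput (k n) σ m (Ξ n))
        - (D n).acceptProb (codedInput (k n) σ m φ)|

/-- `Ξ` is uniformly `(k, ε, s)`-distinguishable from separable states. -/
def UniformlyDistinguishable (G : GateSet) {ℓ : ℕ → ℕ} (k : ℕ → ℕ) (ε : ℕ → ℝ) (s : ℕ → ℕ)
    (Ξ : ∀ n, Qustring (ℓ n)) : Prop :=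
  ∃ D : ∀ n, Circuit G (codeLength (ℓ n) (k n) + ℓ n),
    PUniform D ∧ (∀ n, (D n).size ≤ s n) ∧ IsDistinguisher k ε Ξ D

/-! ### Approximability -/

section

open scoped MatrixOrder

/-- `‖X‖_tr = (1/2) Tr √(X†X)`. -/
def trNorm {ι : Type} [Fintype ι] [DecidableEq ι] (X : Matrix ι ι ℂ) : ℝ :=
  (CFC.sqrt (X.conjTranspose * X)).trace.re / 2

end

/-- The density matrix `|ψ⟩⟨ψ|`. -/
def density {w : ℕ} (ψ : State w) : Matrix (Fin w → Bool) (Fin w → Bool) ℂ :=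
  fun x y => ψ x * star (ψ y)

/-- The partial trace over the last `p` qubits. -/
def traceOut {a p : ℕ} (ρ : Matrix (Fin (a + p) → Bool) (Fin (a + p) → Bool) ℂ) :
    Matrix (Fin a → Bool) (Fin a → Bool) ℂ :=
  fun x y => ∑ z : Fin p → Bool, ρ (Fin.append x z) (Fin.append y z)

/-- `Ξ` is uniformly `(ε, s)`-approximable. -/
def UniformlyApproximable (G : GateSet) {ℓ : ℕ → ℕ} (ε : ℕ → ℝ) (s : ℕ → ℕ)
    (Ξ : ∀ n, Qustring (ℓ n)) : Prop :=
  ∃ C : ∀ n, Circuit G (ℓ n), PUniform C ∧ (∀ n, (C n).size ≤ s n) ∧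
    ∀ᶠ n in Filter.atTop,
      trNorm (traceOut (density ((C n).run (ket fun _ => false))) - density (Ξ n).1) ≤ ε n

/-- `s(n) = n^{O(1)}`. -/
def PolyBounded (s : ℕ → ℕ) : Prop :=
  ∃ c : ℕ, (fun n => (s n : ℝ)) =O[Filter.atTop] fun n => (n : ℝ) ^ c

end QEnt

end

noncomputable section

/-! For `n ≥ 6` the ensemble consists of two maximally entangled pairs on the first four qubits,
tensored with one of four basis states of the remaining qubits. The pairs make it distinguishable;
the free choice among four states makes it hard to approximate.

Distinguishing: the normalised two-pair state has squared overlap at most `1/4` with any product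
across the cut between qubits 1, 2 and qubits 3, 4 (Cauchy–Schwarz, `norm_pairsCoeff_tens_le`). A
single pair would only give `1/2`. A state with `n` separable factors is a product of single qubits,
so the ideal test, a reflection flipping an output qubit from 1 to 0 exactly on the pairs, accepts
such states with probability at least `3/4` and the ensemble with probability 0. Since `3/4 > 1/√2`,
there is room to replace the reflection by a fixed circuit over the universal gate set
(`exists_pairs_test`). The output qubit must start in `|1⟩`; the first bit of the code string
supplies this. Placing the fixed circuit on the right wires for each `n` only changes wire numbers,
which are fixed affine functions of `n(n+7)/2`, so an explicit stack machine prints the descriptions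
(`computable_expand`, `pUniform_tester`).

Not approximating: there are countably many polynomial-time functions (`countable_computable`),
hence countably many uniform families. Against any mixed state, the fidelities with four orthonormal
states sum to at most 1, so one of them is at trace distance at least `3/4` (`exists_far`).
Diagonalising, with each family treated at infinitely many lengths, selects the basis state at each
length (`exists_not_uniformlyApproximable`). The size of the circuits plays no role here. -/

namespace QEnt

/-! ### Countability of the functions computed by Turing machines -/

section Countability

open Turing Turing.TM2

/-- A numbering of the statements of a stack machine whose constituents are all countable. -/
def stmtNumber {K : Type} {Γ : K → Type} {Λ σ : Type} (c₁ : (Σ k, (σ → Γ k)) → ℕ)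
    (c₂ : (Σ k, (σ → Option (Γ k) → σ)) → ℕ) (c₃ : (σ → σ) → ℕ) (c₄ : (σ → Bool) → ℕ)
    (c₅ : (σ → Λ) → ℕ) : Stmt Γ Λ σ → ℕ
  | .push k f q => Nat.pair 0 (Nat.pair (c₁ ⟨k, f⟩) (stmtNumber c₁ c₂ c₃ c₄ c₅ q))
  | .peek k f q => Nat.pair 1 (Nat.pair (c₂ ⟨k, f⟩) (stmtNumber c₁ c₂ c₃ c₄ c₅ q))
  | .pop k f q => Nat.pair 2 (Nat.pair (c₂ ⟨k, f⟩) (stmtNumber c₁ c₂ c₃ c₄ c₅ q))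
  | .load f q => Nat.pair 3 (Nat.pair (c₃ f) (stmtNumber c₁ c₂ c₃ c₄ c₅ q))
  | .branch f q q' => Nat.pair 4 (Nat.pair (c₄ f)
      (Nat.pair (stmtNumber c₁ c₂ c₃ c₄ c₅ q) (stmtNumber c₁ c₂ c₃ c₄ c₅ q')))
  | .goto f => Nat.pair 5 (c₅ f)
  | .halt => Nat.pair 6 0

theorem stmtNumber_injective {K : Type} {Γ : K → Type} {Λ σ : Type} {c₁ : (Σ k, (σ → Γ k)) → ℕ}
    {c₂ : (Σ k, (σ → Option (Γ k) → σ)) → ℕ} {c₃ : (σ → σ) → ℕ} {c₄ : (σ → Bool) → ℕ}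
    {c₅ : (σ → Λ) → ℕ} (h₁ : c₁.Injective) (h₂ : c₂.Injective) (h₃ : c₃.Injective)
    (h₄ : c₄.Injective) (h₅ : c₅.Injective) :
    (stmtNumber c₁ c₂ c₃ c₄ c₅ : Stmt Γ Λ σ → ℕ).Injective := by
  intro q
  induction q with
  | push k f q ih =>
    intro q' h
    cases q' <;> simp [stmtNumber, Nat.pair_eq_pair, h₁.eq_iff] at h
    obtain ⟨⟨rfl, h⟩, h'⟩ := h
    rw [eq_of_heq h, ih h']
  | peek k f q ih =>
    intro q' h
    cases q' <;> simp [stmtNumber, Nat.pair_eq_pair, h₂.eq_iff] at h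
    obtain ⟨⟨rfl, h⟩, h'⟩ := h
    rw [eq_of_heq h, ih h']
  | pop k f q ih =>
    intro q' h
    cases q' <;> simp [stmtNumber, Nat.pair_eq_pair, h₂.eq_iff] at h
    obtain ⟨⟨rfl, h⟩, h'⟩ := h
    rw [eq_of_heq h, ih h']
  | load f q ih =>
    intro q' h
    cases q' <;> simp [stmtNumber, Nat.pair_eq_pair, h₃.eq_iff] at h
    rw [h.1, ih h.2]
  | branch f q₁ q₂ ih₁ ih₂ =>
    intro q' h
    cases q' <;> simp [stmtNumber, Nat.pair_eq_pair, h₄.eq_iff] at h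
    rw [h.1, ih₁ h.2.1, ih₂ h.2.2]
  | goto f =>
    intro q' h
    cases q' <;> simp [stmtNumber, Nat.pair_eq_pair, h₅.eq_iff] at h
    rw [h]
  | halt =>
    intro q' h
    cases q' <;> simp [stmtNumber, Nat.pair_eq_pair] at h
    rfl

instance countable_stmt {K : Type} {Γ : K → Type} {Λ σ : Type} [Finite K] [∀ k, Finite (Γ k)]
    [Finite Λ] [Finite σ] : Countable (Stmt Γ Λ σ) := by
  obtain ⟨c₁, h₁⟩ := exists_injective_nat (Σ k, (σ → Γ k))
  obtain ⟨c₂, h₂⟩ := exists_injective_nat (Σ k, (σ → Option (Γ k) → σ))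
  obtain ⟨c₃, h₃⟩ := exists_injective_nat (σ → σ)
  obtain ⟨c₄, h₄⟩ := exists_injective_nat (σ → Bool)
  obtain ⟨c₅, h₅⟩ := exists_injective_nat (σ → Λ)
  exact (stmtNumber_injective h₁ h₂ h₃ h₄ h₅).countable

/-- The finitely many symbols that a statement can push on stack `k`. -/
def pushed {K : Type} {Γ : K → Type} {Λ σ : Type} (k : K) : Stmt Γ Λ σ → Set (Γ k)
  | .push k' f q => {g | ∃ v, (⟨k', f v⟩ : Σ k, Γ k) = ⟨k, g⟩} ∪ pushed k q
  | .peek _ _ q => pushed k q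
  | .pop _ _ q => pushed k q
  | .load _ q => pushed k q
  | .branch _ q q' => pushed k q ∪ pushed k q'
  | .goto _ => ∅
  | .halt => ∅

/-- In `FinTM2` only the input stack is required to have a finite alphabet, so machines cannot be
counted directly. What saves countability is that a push depends only on the finitely many internal
states, so only finitely many symbols ever matter. -/
theorem finite_pushed {K : Type} {Γ : K → Type} {Λ σ : Type} [Finite σ] (k : K)
    (q : Stmt Γ Λ σ) : (pushed k q).Finite := by
  induction q with
  | push k' f q ih =>
    refine Set.Finite.union ?_ ih
    have : {g | ∃ v, (⟨k', f v⟩ : Σ k, Γ k) = ⟨k, g⟩}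
        = Sigma.mk k ⁻¹' Set.range fun v => (⟨k', f v⟩ : Σ k, Γ k) := by
      ext g; simp
    rw [this]
    exact (Set.finite_range _).preimage (sigma_mk_injective.injOn)
  | peek _ _ q ih => exact ih
  | pop _ _ q ih => exact ih
  | load _ q ih => exact ih
  | branch _ q q' ih ih' => exact ih.union ih'
  | goto _ => exact Set.finite_empty
  | halt => exact Set.finite_empty

/-- A stack machine over initial segments of the natural numbers, with an input symbol and an
interpretation of the output symbols as bits. -/
structure NumericMachine where
  numStacks : ℕ
  numSymbols : Fin numStacks → ℕ
  numLabels : ℕ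
  numStates : ℕ
  program : Fin numLabels → Stmt (fun k => Fin (numSymbols k)) (Fin numLabels) (Fin numStates)
  start : Fin numLabels
  initial : Fin numStates
  inStack : Fin numStacks
  outStack : Fin numStacks
  inSymbol : Fin (numSymbols inStack)
  outBit : Fin (numSymbols outStack) → Bool

set_option synthInstance.maxHeartbeats 200000 in
set_option synthInstance.maxSize 1000 in
instance countable_numericMachine : Countable NumericMachine := by
  let f : NumericMachine → Σ (n : ℕ) (s : Fin n → ℕ) (l : ℕ) (t : ℕ)
      (_ : Fin l → Stmt (fun k => Fin (s k)) (Fin l) (Fin t)) (_ : Fin l) (_ : Fin t)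
      (i : Fin n) (o : Fin n) (_ : Fin (s i)), (Fin (s o) → Bool) :=
    fun M => ⟨M.1, M.2, M.3, M.4, M.5, M.6, M.7, M.8, M.9, M.10, M.11⟩
  have hf : f.Injective := by
    rintro ⟨⟩ ⟨⟩ h
    simp only [f, Sigma.mk.injEq] at h
    obtain ⟨rfl, h⟩ := h
    simp only [heq_eq_eq, Sigma.mk.injEq] at h
    obtain ⟨rfl, h⟩ := h
    simp only [heq_eq_eq, Sigma.mk.injEq] at h
    obtain ⟨rfl, h⟩ := h
    simp only [heq_eq_eq, Sigma.mk.injEq] at h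
    obtain ⟨rfl, h⟩ := h
    simp only [heq_eq_eq, Sigma.mk.injEq] at h
    obtain ⟨rfl, rfl, rfl, rfl, h⟩ := h
    simp only [heq_eq_eq, Sigma.mk.injEq] at h
    obtain ⟨rfl, h⟩ := h
    simp only [heq_eq_eq, Sigma.mk.injEq] at h
    obtain ⟨rfl, rfl⟩ := h
    rfl
  exact hf.countable

/-- The machine `M` halts on the input `1ⁿ` with the output `w`. -/
def NumericMachine.Outputs (M : NumericMachine) (n : ℕ) (w : List Bool) : Prop :=
  ∃ t c, (flip bind (TM2.step M.program))^[t] (some ⟨some M.start, M.initial,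
      Function.update (fun _ => []) M.inStack (List.replicate n M.inSymbol)⟩) = some c ∧
    c.l = none ∧ (c.stk M.outStack).map M.outBit = w

/-- After a halted configuration every further iterate is `none`, so no later configuration exists.
-/
theorem iterate_step_halted {α : Type} {f : α → Option α} {s t : ℕ} {a : Option α} {c d : α}
    (hst : s ≤ t) (hc : (flip bind f)^[s] a = some c) (hd : (flip bind f)^[t] a = some d)
    (h : f c = none) : c = d := by
  obtain ⟨r, rfl⟩ := Nat.exists_eq_add_of_le' hst
  have hn : ∀ r, (flip bind f)^[r] none = none := by
    intro r
    induction r with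
    | zero => rfl
    | succ r ih => rw [Function.iterate_succ_apply]; exact ih
  rw [Function.iterate_add_apply, hc] at hd
  cases r with
  | zero => simpa using hd
  | succ r =>
    rw [Function.iterate_succ_apply] at hd
    have : flip bind f (some c) = none := h
    rw [this, hn] at hd
    cases hd

theorem NumericMachine.Outputs.unique {M : NumericMachine} {n : ℕ} {w w' : List Bool}
    (h : M.Outputs n w) (h' : M.Outputs n w') : w = w' := by
  obtain ⟨s, ⟨_, v, S⟩, hc, rfl, rfl⟩ := h
  obtain ⟨t, ⟨_, v', S'⟩, hd, rfl, rfl⟩ := h'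
  rcases le_total s t with hst | hst
  · rw [iterate_step_halted hst hc hd rfl]
  · rw [iterate_step_halted hst hd hc rfl]

/-! ### Recoding a machine over initial segments of the natural numbers. -/

section Decode

variable {K K' : Type} [DecidableEq K] [DecidableEq K'] {Γ : K → Type} {Γ' : K' → Type}
  {Λ Λ' σ σ' : Type} (e : K ≃ K') (d : ∀ k, Γ' (e k) → Γ k) (l : Λ' ≃ Λ) (s : σ' ≃ σ)

/-- The configuration that a configuration of a recoded machine stands for. -/
def decodeCfg (c : Cfg Γ' Λ' σ') : Cfg Γ Λ σ :=
  ⟨c.l.map l, s c.var, fun k => (c.stk (e k)).map (d k)⟩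

theorem map_update (k : K) (S : ∀ k, List (Γ' k)) (L : List (Γ' (e k))) :
    (fun k₁ => (Function.update S (e k) L (e k₁)).map (d k₁))
      = Function.update (fun k₁ => (S (e k₁)).map (d k₁)) k (L.map (d k)) := by
  funext k₁
  by_cases h : k₁ = k
  · subst h; simp
  · rw [Function.update_of_ne (e.injective.ne h), Function.update_of_ne h]

/-- Symbols are translated only from the new machine to the old one. Peeking and popping decode what
they read, so `d` needs no inverse; a code has to be chosen only for the symbols that are pushed. -/
theorem exists_recoded_stmt (q : Stmt Γ Λ σ) (hq : ∀ k, pushed k q ⊆ Set.range (d k)) :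
    ∃ q' : Stmt Γ' Λ' σ', ∀ v S,
      decodeCfg e d l s (stepAux q' v S) = stepAux q (s v) fun k => (S (e k)).map (d k) := by
  induction q with
  | push k f q ih =>
    obtain ⟨q', h⟩ := ih fun k g hg => hq k (Or.inr hg)
    have : ∀ v, ∃ n, d k n = f v := fun v => hq k (Or.inl ⟨v, rfl⟩)
    choose f' hf' using this
    refine ⟨.push (e k) (fun v => f' (s v)) q', fun v S => ?_⟩
    rw [stepAux, h, stepAux, map_update, List.map_cons, hf']
  | peek k f q ih =>
    obtain ⟨q', h⟩ := ih hq
    refine ⟨.peek (e k) (fun v o => s.symm (f (s v) (o.map (d k)))) q', fun v S => ?_⟩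
    rw [stepAux, h, stepAux, Equiv.apply_symm_apply, List.head?_map]
  | pop k f q ih =>
    obtain ⟨q', h⟩ := ih hq
    refine ⟨.pop (e k) (fun v o => s.symm (f (s v) (o.map (d k)))) q', fun v S => ?_⟩
    rw [stepAux, h, stepAux, map_update, Equiv.apply_symm_apply, List.head?_map, List.map_tail]
  | load f q ih =>
    obtain ⟨q', h⟩ := ih hq
    refine ⟨.load (fun v => s.symm (f (s v))) q', fun v S => ?_⟩
    rw [stepAux, h, stepAux, Equiv.apply_symm_apply]
  | branch f q₁ q₂ ih₁ ih₂ =>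
    obtain ⟨q₁', h₁⟩ := ih₁ fun k g hg => hq k (Or.inl hg)
    obtain ⟨q₂', h₂⟩ := ih₂ fun k g hg => hq k (Or.inr hg)
    refine ⟨.branch (fun v => f (s v)) q₁' q₂', fun v S => ?_⟩
    rw [stepAux, stepAux]
    cases f (s v)
    · exact h₂ v S
    · exact h₁ v S
  | goto f =>
    refine ⟨.goto fun v => l.symm (f (s v)), fun v S => ?_⟩
    simp [decodeCfg]
  | halt => exact ⟨.halt, fun v S => rfl⟩

variable {e d l s}

theorem map_decodeCfg_iterate {m : Λ → Stmt Γ Λ σ} {m' : Λ' → Stmt Γ' Λ' σ'}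
    (h : ∀ a v S, decodeCfg e d l s (stepAux (m' a) v S)
      = stepAux (m (l a)) (s v) fun k => (S (e k)).map (d k)) (t : ℕ)
    (c : Option (Cfg Γ' Λ' σ')) :
    ((flip bind (TM2.step m'))^[t] c).map (decodeCfg e d l s)
      = (flip bind (TM2.step m))^[t] (c.map (decodeCfg e d l s)) := by
  induction t generalizing c with
  | zero => rfl
  | succ t ih =>
    rw [Function.iterate_succ_apply, Function.iterate_succ_apply, ih]
    congr 1
    rcases c with _ | ⟨_ | a, v, S⟩
    · rfl
    · rfl
    · exact congrArg some (h a v S)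

end Decode

theorem initList_stk (tm : FinTM2) (L : List (tm.Γ tm.k₀)) :
    (initList tm L).stk = Function.update (fun _ => []) tm.k₀ L := by
  funext k
  by_cases h : k = tm.k₀
  · subst h; simp [initList]
  · simp [initList, h]

theorem haltList_stk (tm : FinTM2) (L : List (tm.Γ tm.k₁)) :
    (haltList tm L).stk = Function.update (fun _ => []) tm.k₁ L := by
  funext k
  by_cases h : k = tm.k₁
  · subst h; simp [haltList]
  · simp [haltList, h]

theorem exists_numericMachine {f : ℕ → List Bool}
    (h : TM2Computable (fun n : ℕ => List.replicate n true) (id : List Bool → List Bool) f) :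
    ∃ M : NumericMachine, ∀ n, M.Outputs n (f n) := by
  classical
  obtain ⟨⟨tm, iA, oA⟩, hout⟩ := h
  -- All symbols that can ever occur: the pushed ones, and the single input symbol, since the input
  -- is a string of ones.
  let P : ∀ k, Set (tm.Γ k) := fun k =>
    (⋃ a, pushed k (tm.m a)) ∪ {g | (⟨k, g⟩ : Σ k, tm.Γ k) = ⟨tm.k₀, iA.symm true⟩}
  have := tm.kFin
  have := tm.σFin
  have := tm.ΛFin
  have hP : ∀ k, (P k).Finite := fun k => by
    refine (Set.finite_iUnion fun a => finite_pushed k _).union ?_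
    exact (Set.finite_singleton (⟨tm.k₀, iA.symm true⟩ : Σ k, tm.Γ k)).preimage
      sigma_mk_injective.injOn
  have : ∀ k, ∃ (n : ℕ) (d : Fin n → tm.Γ k), P k ⊆ Set.range d := fun k => by
    obtain ⟨n, d, -, hd⟩ := (hP k).fin_param
    exact ⟨n, d, hd.ge⟩
  choose num d hd using this
  let e := Fintype.equivFin tm.K
  let l := (Fintype.equivFin tm.Λ).symm
  let s := (Fintype.equivFin tm.σ).symm
  obtain ⟨N, hN⟩ : ∃ N : Fin (Fintype.card tm.K) → ℕ, ∀ k, N (e k) = num k :=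
    ⟨fun k => num (e.symm k), fun k => by simp⟩
  let D : ∀ k, Fin (N (e k)) → tm.Γ k := fun k i => d k (Fin.cast (hN k) i)
  have hD : ∀ k, P k ⊆ Set.range (D k) := fun k g hg => by
    obtain ⟨i, rfl⟩ := hd k hg
    exact ⟨Fin.cast (hN k).symm i, rfl⟩
  have hq : ∀ a, ∃ q' : Stmt (fun k => Fin (N k)) (Fin (Fintype.card tm.Λ))
      (Fin (Fintype.card tm.σ)), ∀ v S, decodeCfg e D l s (stepAux q' v S)
        = stepAux (tm.m (l a)) (s v) fun k => (S (e k)).map (D k) := fun a =>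
    exists_recoded_stmt (Γ' := fun k => Fin (N k)) e D l s (tm.m (l a)) fun k g hg => hD k (Or.inl (Set.mem_iUnion.2 ⟨_, hg⟩))
  choose m' hm' using hq
  obtain ⟨i, hi⟩ : ∃ i, D tm.k₀ i = iA.symm true := hD tm.k₀ (Or.inr rfl)
  refine ⟨⟨_, N, _, _, m', l.symm tm.main, s.symm tm.initialState, e tm.k₀, e tm.k₁, i,
    fun j => oA (D _ j)⟩, fun n => ?_⟩
  obtain ⟨t, ht⟩ := hout n
  have key := map_decodeCfg_iterate hm' t (some ⟨some (l.symm tm.main), s.symm tm.initialState,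
    Function.update (fun _ => []) (e tm.k₀) (List.replicate n i)⟩)
  have h0 : (some (⟨some (l.symm tm.main), s.symm tm.initialState, Function.update (fun _ => [])
      (e tm.k₀) (List.replicate n i)⟩ : Cfg (fun k => Fin (N k)) _ _)).map (decodeCfg e D l s)
      = some (initList tm (List.map iA.invFun (List.replicate n true))) := by
    have := initList_stk tm (List.map iA.invFun (List.replicate n true))
    rw [Option.map_some]
    congr 1
    refine Cfg.mk.injEq .. ▸ ⟨?_, ?_, ?_⟩
    · simp
    · simp
    · refine Eq.trans (map_update (Γ' := fun k => Fin (N k)) e D tm.k₀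
        (fun _ => []) (List.replicate n i)) (Eq.trans ?_ this.symm)
      simp [hi, List.map_replicate]
  rw [h0] at key
  have key := key.trans ht
  obtain ⟨c, hc, hc'⟩ := Option.map_eq_some_iff.1 key
  refine ⟨t, c, hc, ?_, ?_⟩
  · have := congrArg Cfg.l hc'
    simpa [decodeCfg, haltList] using this
  · have h1 := congrFun (congrArg Cfg.stk hc') tm.k₁
    have h2 := congrFun (haltList_stk tm (List.map oA.invFun (id (f n)))) tm.k₁
    have h3 := congrArg (List.map oA) (h1.trans h2)
    simpa [decodeCfg, Function.comp_def] using h3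

theorem countable_computable : {f : ℕ → List Bool | Nonempty (TM2ComputableInPolyTime
    (fun n : ℕ => List.replicate n true) (id : List Bool → List Bool) f)}.Countable := by
  have : ∀ f : {f : ℕ → List Bool | Nonempty (TM2ComputableInPolyTime
      (fun n : ℕ => List.replicate n true) (id : List Bool → List Bool) f)},
      ∃ M : NumericMachine, ∀ n, M.Outputs n (f.1 n) := fun f =>
    exists_numericMachine f.2.some.toTM2ComputableInTime.toTM2Computable
  choose M hM using this
  -- A machine has at most one output on each input, so it determines the function it computes.
  have hi : M.Injective := fun f g h => Subtype.ext <| funext fun n =>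
    (hM f n).unique (h ▸ hM g n)
  exact hi.countable

end Countability

/-! ### A machine for words with blocks of quadratic length -/

section Printer

open Turing Turing.TM2

/-- The number `n(n + 7)/2`. -/
def blockLength (n : ℕ) : ℕ := (n ^ 2 + 5 * n) / 2 + n

/-- This recursion is the loop of the printing machine: remove one input symbol, push four ones,
then one more for each of the `n` remaining symbols. -/
theorem blockLength_succ (n : ℕ) : blockLength (n + 1) = n + 4 + blockLength n := by
  have : (n + 1) ^ 2 + 5 * (n + 1) = (n ^ 2 + 5 * n) + (n + 3) * 2 := by ring
  rw [blockLength, blockLength, this, Nat.add_mul_div_right _ _ (by norm_num)]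
  omega

theorem blockLength_le (n : ℕ) : blockLength n ≤ (n + 3) ^ 2 := by
  induction n with
  | zero => simp [blockLength]
  | succ n ih => rw [blockLength_succ]; nlinarith

/-- Replace every `none` by the block `1ᵃ`. -/
def expand (a : ℕ) (W : List (Option Bool)) : List Bool :=
  W.flatMap fun o => o.elim (List.replicate a true) fun b => [b]

/-- `c` leads to `c'` in exactly `t` steps of `f`. -/
def StepsTo {α : Type} (f : α → Option α) (t : ℕ) (c c' : α) : Prop :=
  (flip bind f)^[t] (some c) = some c'

theorem StepsTo.head {α : Type} {f : α → Option α} {t : ℕ} {c c' c'' : α} (h : f c = some c')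
    (h' : StepsTo f t c' c'') : StepsTo f (t + 1) c c'' := by
  have : flip bind f (some c) = some c' := h
  rw [StepsTo, Function.iterate_succ_apply, this]
  exact h'

theorem StepsTo.trans {α : Type} {f : α → Option α} {s t : ℕ} {c c' c'' : α}
    (h : StepsTo f s c c') (h' : StepsTo f t c' c'') : StepsTo f (s + t) c c'' := by
  rw [StepsTo, add_comm, Function.iterate_add_apply, h]
  exact h'

theorem StepsTo.single {α : Type} {f : α → Option α} {c c' : α} (h : f c = some c') :
    StepsTo f 1 c c' := h

/-- The labels of the printing machine: three for the computation of the block, and two for each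
position in the word. -/
abbrev PrinterLabel (r : ℕ) : Type := Fin 3 ⊕ Fin (r + 1) × Bool

/-- The contents of the five stacks of the printing machine: the input, a copy of it, the block,
a copy of it, and the output. -/
def printerStacks (i y a b o : List Bool) : Fin 5 → List Bool := ![i, y, a, b, o]

variable (R : List (Option Bool))

/-- The program of the printing machine: first compute a block on stack `2`, then print the
reversed word `R`. -/
def printer : PrinterLabel R.length → Stmt (fun _ : Fin 5 => Bool) (PrinterLabel R.length) Bool
  | .inl 0 => .pop 0 (fun _ o => o.isSome) <| .branch id
      (.push 2 (fun _ => true) <| .push 2 (fun _ => true) <| .push 2 (fun _ => true) <|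
        .push 2 (fun _ => true) <| .goto fun _ => .inl 1)
      (.goto fun _ => .inr (Fin.ofNat _ 0, false))
  | .inl 1 => .pop 0 (fun _ o => o.isSome) <| .branch id
      (.push 1 (fun _ => true) <| .push 2 (fun _ => true) <| .goto fun _ => .inl 1)
      (.goto fun _ => .inl 2)
  | .inl 2 => .pop 1 (fun _ o => o.isSome) <| .branch id
      (.push 0 (fun _ => true) <| .goto fun _ => .inl 2)
      (.goto fun _ => .inl 0)
  | .inr (t, false) => match R[(t : ℕ)]? with
    | none => .pop 2 (fun _ o => o.isSome) <| .branch id (.goto fun _ => .inr (t, false)) .halt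
    | some (some b) => .push 4 (fun _ => b) <| .goto fun _ => .inr (Fin.ofNat _ (t + 1), false)
    | some none => .pop 2 (fun _ o => o.isSome) <| .branch id
        (.push 3 (fun _ => true) <| .push 4 (fun _ => true) <| .goto fun _ => .inr (t, false))
        (.goto fun _ => .inr (t, true))
  | .inr (t, true) => .pop 3 (fun _ o => o.isSome) <| .branch id
      (.push 2 (fun _ => true) <| .goto fun _ => .inr (t, true))
      (.goto fun _ => .inr (Fin.ofNat _ (t + 1), false))

/-- A configuration of the printing machine. -/
def printerCfg (l : Option (PrinterLabel R.length)) (v : Bool) (i y a b o : List Bool) :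
    Cfg (fun _ : Fin 5 => Bool) (PrinterLabel R.length) Bool :=
  ⟨l, v, printerStacks i y a b o⟩

theorem update_printerStacks (i y a b o L : List Bool) :
    Function.update (printerStacks i y a b o) 0 L = printerStacks L y a b o ∧
    Function.update (printerStacks i y a b o) 1 L = printerStacks i L a b o ∧
    Function.update (printerStacks i y a b o) 2 L = printerStacks i y L b o ∧
    Function.update (printerStacks i y a b o) 3 L = printerStacks i y a L o ∧
    Function.update (printerStacks i y a b o) 4 L = printerStacks i y a b L := by
  refine ⟨?_, ?_, ?_, ?_, ?_⟩ <;> funext k <;> fin_cases k <;> rfl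

theorem printerStacks_apply (i y a b o : List Bool) :
    printerStacks i y a b o 0 = i ∧ printerStacks i y a b o 1 = y ∧ printerStacks i y a b o 2 = a ∧
      printerStacks i y a b o 3 = b ∧ printerStacks i y a b o 4 = o :=
  ⟨rfl, rfl, rfl, rfl, rfl⟩

variable {R}

theorem printer_copyInput (r s k : ℕ) (v : Bool) :
    StepsTo (TM2.step (printer R)) (r + 1)
      (printerCfg R (some (.inl 1)) v (List.replicate r true) (List.replicate s true) (List.replicate k true) [] [])
      (printerCfg R (some (.inl 2)) false [] (List.replicate (s + r) true) (List.replicate (k + r) true) [] []) := by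
  induction r generalizing s k v with
  | zero =>
    refine StepsTo.single ?_
    simp [printerCfg, TM2.step, printer, printerStacks_apply, update_printerStacks]
  | succ r ih =>
    have := ih (s + 1) (k + 1) true
    rw [show s + 1 + r = s + (r + 1) by omega, show k + 1 + r = k + (r + 1) by omega] at this
    refine StepsTo.head ?_ this
    simp [printerCfg, TM2.step, printer, printerStacks_apply, update_printerStacks, List.replicate_succ]

theorem printer_restoreInput (r s : ℕ) (A : List Bool) (v : Bool) :
    StepsTo (TM2.step (printer R)) (r + 1)
      (printerCfg R (some (.inl 2)) v (List.replicate s true) (List.replicate r true) A [] [])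
      (printerCfg R (some (.inl 0)) false (List.replicate (s + r) true) [] A [] []) := by
  induction r generalizing s v with
  | zero =>
    refine StepsTo.single ?_
    simp [printerCfg, TM2.step, printer, printerStacks_apply, update_printerStacks]
  | succ r ih =>
    have := ih (s + 1) true
    rw [show s + 1 + r = s + (r + 1) by omega] at this
    refine StepsTo.head ?_ this
    simp [printerCfg, TM2.step, printer, printerStacks_apply, update_printerStacks, List.replicate_succ]

theorem printer_block (n k : ℕ) (v : Bool) :
    StepsTo (TM2.step (printer R)) ((n + 1) ^ 2)
      (printerCfg R (some (.inl 0)) v (List.replicate n true) [] (List.replicate k true) [] [])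
      (printerCfg R (some (.inr (Fin.ofNat _ 0, false))) false [] []
        (List.replicate (k + blockLength n) true) [] []) := by
  induction n generalizing k v with
  | zero =>
    refine StepsTo.single ?_
    simp [printerCfg, TM2.step, printer, printerStacks_apply, update_printerStacks, blockLength]
  | succ n ih =>
    have h1 := printer_copyInput (R := R) n 0 (k + 4) true
    have h2 := printer_restoreInput (R := R) n 0 (List.replicate (k + 4 + n) true) false
    simp only [Nat.zero_add, List.replicate_zero] at h1 h2
    have h := (h1.trans h2).trans (ih (k + 4 + n) false)
    rw [show k + 4 + n + blockLength n = k + blockLength (n + 1) by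
      rw [blockLength_succ]; omega] at h
    -- One step for the removed symbol, two passes of `n + 1` steps to copy and restore the input,
    -- then the remaining rounds.
    rw [show (n + 1 + 1) ^ 2 = n + 1 + (n + 1) + (n + 1) ^ 2 + 1 by ring]
    refine StepsTo.head ?_ h
    simp [printerCfg, TM2.step, printer, printerStacks_apply, update_printerStacks, List.replicate_succ]

theorem printer_printBlock {t : Fin (R.length + 1)} (ht : R[(t : ℕ)]? = some none) (r s : ℕ)
    (O : List Bool) (v : Bool) :
    StepsTo (TM2.step (printer R)) (r + 1)
      (printerCfg R (some (.inr (t, false))) v [] [] (List.replicate r true) (List.replicate s true) O)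
      (printerCfg R (some (.inr (t, true))) false [] [] [] (List.replicate (s + r) true) (List.replicate r true ++ O)) := by
  induction r generalizing s O v with
  | zero =>
    refine StepsTo.single ?_
    simp [printerCfg, TM2.step, printer, printerStacks_apply, update_printerStacks, ht]
  | succ r ih =>
    have := ih (s + 1) (true :: O) true
    rw [show s + 1 + r = s + (r + 1) by omega] at this
    have e : (List.replicate r true) ++ true :: O = (List.replicate (r + 1) true) ++ O := by
      simp [List.replicate_succ']
    rw [e] at this
    refine StepsTo.head ?_ this
    simp [printerCfg, TM2.step, printer, printerStacks_apply, update_printerStacks, List.replicate_succ, ht]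

theorem printer_restoreBlock (t : Fin (R.length + 1)) (r s : ℕ) (O : List Bool) (v : Bool) :
    StepsTo (TM2.step (printer R)) (r + 1)
      (printerCfg R (some (.inr (t, true))) v [] [] (List.replicate s true) (List.replicate r true) O)
      (printerCfg R (some (.inr (Fin.ofNat _ (t + 1), false))) false [] []
        (List.replicate (s + r) true) [] O) := by
  induction r generalizing s v with
  | zero =>
    refine StepsTo.single ?_
    simp [printerCfg, TM2.step, printer, printerStacks_apply, update_printerStacks]
  | succ r ih =>
    have := ih (s + 1) true
    rw [show s + 1 + r = s + (r + 1) by omega] at this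
    refine StepsTo.head ?_ this
    simp [printerCfg, TM2.step, printer, printerStacks_apply, update_printerStacks, List.replicate_succ]

/-- `haltList` demands that every stack except the output is empty, so the block has to be erased
before halting. -/
theorem printer_clear {t : Fin (R.length + 1)} (ht : R[(t : ℕ)]? = none) (r : ℕ)
    (O : List Bool) (v : Bool) :
    StepsTo (TM2.step (printer R)) (r + 1)
      (printerCfg R (some (.inr (t, false))) v [] [] (List.replicate r true) [] O)
      (printerCfg R none false [] [] [] [] O) := by
  induction r generalizing v with
  | zero =>
    refine StepsTo.single ?_
    simp [printerCfg, TM2.step, printer, printerStacks_apply, update_printerStacks, ht]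
  | succ r ih =>
    refine StepsTo.head ?_ (ih true)
    simp [printerCfg, TM2.step, printer, printerStacks_apply, update_printerStacks, List.replicate_succ, ht]

theorem printer_printBit {t : Fin (R.length + 1)} {b : Bool} (ht : R[(t : ℕ)]? = some (some b))
    (A O : List Bool) (v : Bool) :
    TM2.step (printer R) (printerCfg R (some (.inr (t, false))) v [] [] A [] O)
      = some (printerCfg R (some (.inr (Fin.ofNat _ (t + 1), false))) v [] [] A [] (b :: O)) := by
  simp [printerCfg, TM2.step, printer, printerStacks_apply, update_printerStacks, ht]

theorem printer_print (a : ℕ) (Q : List (Option Bool)) (t : ℕ) (ht : t ≤ R.length)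
    (hQ : R.drop t = Q) (O : List Bool) (v : Bool) :
    ∃ T ≤ Q.length * (2 * a + 2) + a + 1, StepsTo (TM2.step (printer R)) T
      (printerCfg R (some (.inr (Fin.ofNat _ t, false))) v [] [] (List.replicate a true) [] O)
      (printerCfg R none false [] [] [] [] (expand a Q.reverse ++ O)) := by
  -- There is one label position beyond the word, so the reduction modulo `R.length + 1` never wraps
  -- around.
  have hv : ((Fin.ofNat (R.length + 1) t : Fin (R.length + 1)) : ℕ) = t :=
    Nat.mod_eq_of_lt (by omega)
  induction Q generalizing t O v with
  | nil =>
    refine ⟨a + 1, by omega, ?_⟩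
    refine printer_clear ?_ a O v
    rw [hv]
    exact List.getElem?_eq_none (List.drop_eq_nil_iff.1 hQ)
  | cons q Q ih =>
    have hlt : t < R.length := by
      by_contra h
      rw [List.drop_eq_nil_of_le (not_lt.1 h)] at hQ
      cases hQ
    have hq : R[t]? = some q := by
      rw [← List.head?_drop, hQ]; rfl
    have hd : R.drop (t + 1) = Q := by
      rw [← List.tail_drop, hQ]; rfl
    cases q with
    | none =>
      obtain ⟨T, hT, h⟩ := ih (t + 1) hlt hd (List.replicate a true ++ O) false
        (Nat.mod_eq_of_lt (by omega))
      have h1 := printer_printBlock (t := Fin.ofNat _ t) (by rw [hv]; exact hq) a 0 O v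
      have h2 := printer_restoreBlock (R := R) (Fin.ofNat _ t) a 0 (List.replicate a true ++ O) false
      rw [hv] at h2
      simp only [Nat.zero_add, List.replicate_zero] at h1 h2
      refine ⟨a + 1 + (a + 1) + T, ?_, ?_⟩
      · simp only [List.length_cons]
        linarith [add_mul Q.length 1 (2 * a + 2)]
      · have e : expand a Q.reverse ++ (List.replicate a true ++ O)
            = expand a (none :: Q).reverse ++ O := by
          simp [expand]
        rw [e] at h
        exact (h1.trans h2).trans h
    | some b =>
      obtain ⟨T, hT, h⟩ := ih (t + 1) hlt hd (b :: O) v (Nat.mod_eq_of_lt (by omega))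
      refine ⟨T + 1, ?_, ?_⟩
      · simp only [List.length_cons]
        linarith [add_mul Q.length 1 (2 * a + 2)]
      · have e : expand a Q.reverse ++ b :: O = expand a (some b :: Q).reverse ++ O := by
          simp [expand]
        rw [e] at h
        have h1 := printer_printBit (t := Fin.ofNat _ t) (by rw [hv]; exact hq)
          (List.replicate a true) O v
        rw [hv] at h1
        exact StepsTo.head h1 h

variable (R)

/-- The printing machine. -/
def printerMachine : FinTM2 where
  K := Fin 5
  k₀ := 0
  k₁ := 4
  Γ := fun _ => Bool
  Λ := PrinterLabel R.length
  main := .inl 0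
  σ := Bool
  initialState := false
  Γk₀Fin := inferInstanceAs (Fintype Bool)
  m := printer R

theorem printer_computes (n : ℕ) :
    ∃ T ≤ (n + 1) ^ 2 + (R.length * (2 * (n + 3) ^ 2 + 2) + (n + 3) ^ 2 + 1),
      StepsTo (TM2.step (printer R)) T
        (printerCfg R (some (.inl 0)) false (List.replicate n true) [] [] [] [])
        (printerCfg R none false [] [] [] [] (expand (blockLength n) R.reverse)) := by
  obtain ⟨T, hT, h⟩ := printer_print (R := R) (blockLength n) R 0 (Nat.zero_le _)
    (List.drop_zero) [] false
  have h' := printer_block (R := R) n 0 false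
  rw [Nat.zero_add] at h'
  rw [List.append_nil] at h
  have hb := blockLength_le n
  have := Nat.mul_le_mul_left R.length (show 2 * blockLength n + 2 ≤ 2 * (n + 3) ^ 2 + 2 by omega)
  exact ⟨_, by omega, h'.trans h⟩

/-- Words with a fixed pattern of blocks of length `blockLength n` are computable in polynomial
time from `1ⁿ`. -/
theorem computable_expand (W : List (Option Bool)) : Nonempty (TM2ComputableInPolyTime
    (fun n : ℕ => List.replicate n true) (id : List Bool → List Bool)
    (fun n => expand (blockLength n) W)) := by
  choose T hT h using printer_computes W.reverse
  refine ⟨⟨⟨printerMachine W.reverse, Equiv.refl _, Equiv.refl _⟩,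
    (.X + 1) ^ 2 + (.C W.length * (2 * (.X + 3) ^ 2 + 2) + (.X + 3) ^ 2 + 1),
    fun n => ⟨⟨T n, ?_⟩, ?_⟩⟩⟩
  · have h := h n
    have hi : initList (printerMachine W.reverse) (List.replicate n true)
        = printerCfg W.reverse (some (.inl 0)) false (List.replicate n true) [] [] [] [] := by
      refine Cfg.mk.injEq .. ▸ ⟨rfl, rfl, ?_⟩
      refine (initList_stk (printerMachine W.reverse) (List.replicate n true)).trans ?_
      exact (funext fun k : Fin 5 => by fin_cases k <;> rfl)
    have ho : haltList (printerMachine W.reverse) (expand (blockLength n) W)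
        = printerCfg W.reverse none false [] [] [] [] (expand (blockLength n) W) := by
      refine Cfg.mk.injEq .. ▸ ⟨rfl, rfl, ?_⟩
      refine (haltList_stk (printerMachine W.reverse) _).trans ?_
      exact (funext fun k : Fin 5 => by fin_cases k <;> rfl)
    rw [List.reverse_reverse] at h
    rw [StepsTo, ← hi, ← ho] at h
    simp only [Equiv.invFun_as_coe, Equiv.refl_symm, Equiv.coe_refl]
    erw [List.map_id, List.map_id]
    exact h
  · simpa using hT n

end Printer

/-! ### Circuits placed on some of the wires -/

section Wires

variable {G : GateSet} {v w : ℕ}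

theorem sum_norm_sq_unitary {ι : Type} [Fintype ι] [DecidableEq ι]
    (U : Matrix.unitaryGroup ι ℂ) (f : ι → ℂ) :
    ∑ i, ‖∑ j, U.1 i j * f j‖ ^ 2 = ∑ i, ‖f i‖ ^ 2 := by
  have h : ∀ g : ι → ℂ, ((∑ i, ‖g i‖ ^ 2 : ℝ) : ℂ) = star g ⬝ᵥ g := by
    intro g
    simp [dotProduct, Complex.conj_mul']
  have key : star (U.1.mulVec f) ⬝ᵥ (U.1.mulVec f) = star f ⬝ᵥ f := by
    rw [Matrix.star_mulVec, Matrix.dotProduct_mulVec, Matrix.vecMul_vecMul,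
      ← Matrix.star_eq_conjTranspose, Matrix.mem_unitaryGroup_iff'.1 U.2, Matrix.vecMul_one]
  rw [← h, ← h] at key
  exact_mod_cast key

/-- Overwriting the bits on the wires `e`, keeping the old ones, is reversible. -/
theorem involutive_extend (e : Fin v ↪ Fin w) :
    Function.Involutive fun p : (Fin w → Bool) × (Fin v → Bool) =>
      (Function.extend e p.2 p.1, fun i => p.1 (e i)) := by
  rintro ⟨x, y⟩
  refine Prod.ext ?_ ?_
  · funext i
    by_cases h : ∃ a, e a = i
    · obtain ⟨a, rfl⟩ := h
      simp [e.injective.extend_apply]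
    · simp [Function.extend_apply' _ _ _ h]
  · funext i
    simp [e.injective.extend_apply]

theorem sum_extend (e : Fin v ↪ Fin w) (F : (Fin w → Bool) → ℝ) :
    ∑ x, ∑ y, F (Function.extend e y x) = 2 ^ v * ∑ x, F x := by
  rw [← Fintype.sum_prod_type' (f := fun x y => F (Function.extend e y x))]
  refine (Equiv.sum_comp (involutive_extend e).toPerm
    (fun p : (Fin w → Bool) × (Fin v → Bool) => F p.1)).trans ?_
  simp [Fintype.sum_prod_type, Finset.mul_sum]

/-- The restriction of a state to the wires `e`, the other wires being fixed to the bits of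
`x`. -/
def slice (e : Fin v ↪ Fin w) (x : Fin w → Bool) (ψ : State w) : State v :=
  WithLp.toLp 2 fun y => ψ (Function.extend e y x)

theorem extend_extend {u : ℕ} (f : Fin u ↪ Fin v) (e : Fin v ↪ Fin w) (b : Fin u → Bool)
    (y : Fin v → Bool) (x : Fin w → Bool) :
    Function.extend (f.trans e) b (Function.extend e y x)
      = Function.extend e (Function.extend f b y) x := by
  funext i
  by_cases h : ∃ a, e a = i
  · obtain ⟨a, rfl⟩ := h
    rw [e.injective.extend_apply]
    by_cases h' : ∃ c, f c = a
    · obtain ⟨c, rfl⟩ := h'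
      rw [f.injective.extend_apply]
      exact (f.trans e).injective.extend_apply b _ c
    · rw [Function.extend_apply' _ _ _ h', Function.extend_apply', e.injective.extend_apply]
      rintro ⟨c, hc⟩
      exact h' ⟨c, e.injective hc⟩
  · rw [Function.extend_apply' _ _ _ h, Function.extend_apply', Function.extend_apply' _ _ _ h]
    rintro ⟨c, hc⟩
    exact h ⟨f c, hc⟩

theorem extend_self_extend (e : Fin v ↪ Fin w) (b y : Fin v → Bool) (x : Fin w → Bool) :
    Function.extend e b (Function.extend e y x) = Function.extend e b x := by
  funext i
  by_cases h : ∃ a, e a = i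
  · obtain ⟨a, rfl⟩ := h
    simp [e.injective.extend_apply]
  · simp [Function.extend_apply' _ _ _ h]

theorem norm_sq_slice (e : Fin v ↪ Fin w) (ψ : State w) :
    ∑ x, ‖slice e x ψ‖ ^ 2 = 2 ^ v * ‖ψ‖ ^ 2 := by
  simp only [EuclideanSpace.norm_sq_eq]
  exact sum_extend e fun x => ‖ψ x‖ ^ 2

/-- On each slice along its own wires the gate acts by its unitary matrix, and the squared norms of
the slices add up to a fixed multiple of the squared norm. -/
theorem PlacedGate.norm_apply (g : PlacedGate G w) (ψ : State w) : ‖g.apply ψ‖ = ‖ψ‖ := by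
  have h : ∀ x, ‖slice g.wires x (g.apply ψ)‖ ^ 2 = ‖slice g.wires x ψ‖ ^ 2 := by
    intro x
    rw [EuclideanSpace.norm_sq_eq, EuclideanSpace.norm_sq_eq,
      ← sum_norm_sq_unitary (G.op g.gate) (slice g.wires x ψ)]
    refine Finset.sum_congr rfl fun y _ => ?_
    simp only [slice, PlacedGate.apply, extend_self_extend, g.wires.injective.extend_apply]
  have h' := norm_sq_slice g.wires (g.apply ψ)
  rw [Finset.sum_congr rfl fun x _ => h x, norm_sq_slice] at h'
  have := mul_left_cancel₀ (pow_ne_zero _ two_ne_zero) h'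
  exact (sq_eq_sq₀ (norm_nonneg _) (norm_nonneg _)).1 this.symm

/-- The action of a list of gates. -/
def applyGates (L : List (PlacedGate G w)) (ψ : State w) : State w :=
  L.foldl (fun φ g => g.apply φ) ψ

theorem norm_applyGates (L : List (PlacedGate G w)) (ψ : State w) : ‖applyGates L ψ‖ = ‖ψ‖ := by
  induction L generalizing ψ with
  | nil => rfl
  | cons g L ih => exact (ih _).trans (g.norm_apply ψ)

theorem PlacedGate.apply_smul (g : PlacedGate G w) (c : ℂ) (ψ : State w) :
    g.apply (c • ψ) = c • g.apply ψ := by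
  ext x
  simp only [PlacedGate.apply, PiLp.smul_apply, smul_eq_mul, Finset.mul_sum]
  exact Finset.sum_congr rfl fun b _ => by ring

theorem applyGates_smul (L : List (PlacedGate G w)) (c : ℂ) (ψ : State w) :
    applyGates L (c • ψ) = c • applyGates L ψ := by
  induction L generalizing ψ with
  | nil => rfl
  | cons g L ih =>
    change applyGates L (g.apply (c • ψ)) = c • applyGates L (g.apply ψ)
    rw [g.apply_smul, ih]

/-- Move a gate along an embedding of the wires. -/
def PlacedGate.map (e : Fin v ↪ Fin w) (g : PlacedGate G v) : PlacedGate G w :=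
  ⟨g.gate, g.wires.trans e⟩

theorem slice_map_apply (e : Fin v ↪ Fin w) (x : Fin w → Bool) (g : PlacedGate G v)
    (ψ : State w) : slice e x ((g.map e).apply ψ) = g.apply (slice e x ψ) := by
  ext y
  refine Finset.sum_congr rfl fun b _ => ?_
  refine congrArg₂ (· * ·) ?_ (congrArg ψ (extend_extend _ _ _ _ _))
  refine congrArg (fun z => (G.op g.gate).1 z b) (funext fun j => ?_)
  exact e.injective.extend_apply _ _ _

theorem slice_applyGates (e : Fin v ↪ Fin w) (x : Fin w → Bool) (L : List (PlacedGate G v))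
    (ψ : State w) :
    slice e x (applyGates (L.map (PlacedGate.map e)) ψ) = applyGates L (slice e x ψ) := by
  induction L generalizing ψ with
  | nil => rfl
  | cons g L ih =>
    change slice e x (applyGates (L.map (PlacedGate.map e)) ((g.map e).apply ψ))
      = applyGates L (g.apply (slice e x ψ))
    rw [ih, slice_map_apply]

theorem sum_append {a b : ℕ} {M : Type} [AddCommMonoid M] (F : (Fin (a + b) → Bool) → M) :
    ∑ x, F x = ∑ y : Fin a → Bool, ∑ z : Fin b → Bool, F (Fin.append y z) := by
  rw [← Equiv.sum_comp (Fin.appendEquiv a b) F, Fintype.sum_prod_type]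
  rfl

theorem tens_append {a b : ℕ} (ψ : State a) (η : State b) (y : Fin a → Bool) (z : Fin b → Bool) :
    tens ψ η (Fin.append y z) = ψ y * η z := by
  simp [tens]

theorem norm_tens {a b : ℕ} (ψ : State a) (η : State b) : ‖tens ψ η‖ = ‖ψ‖ * ‖η‖ := by
  have : ‖tens ψ η‖ ^ 2 = (‖ψ‖ * ‖η‖) ^ 2 := by
    rw [mul_pow, EuclideanSpace.norm_sq_eq, EuclideanSpace.norm_sq_eq, EuclideanSpace.norm_sq_eq,
      sum_append]
    simp only [tens_append, norm_mul, mul_pow, Finset.sum_mul_sum]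
  exact (sq_eq_sq₀ (norm_nonneg _) (by positivity)).1 this

theorem norm_ket (x : Fin w → Bool) : ‖ket x‖ = 1 := by
  simp [ket]

/-- The part of a state where the first qubit is `1`. -/
def firstOne (ψ : State w) : State w :=
  WithLp.toLp 2 fun x => if ∃ h : 0 < w, x ⟨0, h⟩ = true then ψ x else 0

theorem acceptProb_eq {a : ℕ} (C : Circuit G a) (ψ : State a) :
    C.acceptProb ψ = ‖firstOne (C.run ψ)‖ ^ 2 := by
  classical
  rw [EuclideanSpace.norm_sq_eq, Circuit.acceptProb]
  refine Finset.sum_congr rfl fun x _ => ?_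
  by_cases h : ∃ h : 0 < a + C.ancillas, x ⟨0, h⟩ = true
  · simp only [firstOne, if_pos h]
  · simp only [firstOne, if_neg h, norm_zero, ne_eq, OfNat.ofNat_ne_zero, not_false_eq_true,
      zero_pow]

theorem firstOne_smul (c : ℂ) (ψ : State w) : firstOne (c • ψ) = c • firstOne ψ := by
  ext x
  simp [firstOne]

theorem firstOne_sub (ψ φ : State w) : firstOne (ψ - φ) = firstOne ψ - firstOne φ := by
  ext x
  by_cases h : ∃ h : 0 < w, x ⟨0, h⟩ = true <;> simp [firstOne, h]

theorem norm_firstOne_le (ψ : State w) : ‖firstOne ψ‖ ≤ ‖ψ‖ := by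
  rw [← sq_le_sq₀ (norm_nonneg _) (norm_nonneg _), EuclideanSpace.norm_sq_eq,
    EuclideanSpace.norm_sq_eq]
  refine Finset.sum_le_sum fun x _ => ?_
  by_cases h : ∃ h : 0 < w, x ⟨0, h⟩ = true <;> simp [firstOne, h]

theorem firstOne_tens {a b : ℕ} (ha : 0 < a) (ψ : State a) (η : State b) :
    firstOne (tens ψ η) = tens (firstOne ψ) η := by
  ext x
  by_cases h : x (Fin.castAdd b ⟨0, ha⟩) = true
  · have h' : x ⟨0, Nat.add_pos_left ha b⟩ = true := h
    simp [firstOne, tens, h', ha]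
  · have h' : ¬ x ⟨0, Nat.add_pos_left ha b⟩ = true := h
    simp [firstOne, tens, h', ha]

theorem slice_firstOne (hv : 0 < v) (hw : 0 < w) (e : Fin v ↪ Fin w)
    (he : e ⟨0, hv⟩ = ⟨0, hw⟩) (x : Fin w → Bool) (ψ : State w) :
    slice e x (firstOne ψ) = firstOne (slice e x ψ) := by
  ext y
  have : Function.extend e y x ⟨0, hw⟩ = y ⟨0, hv⟩ := by rw [← he, e.injective.extend_apply]
  simp [slice, firstOne, this, hv, hw]

/-- If a circuit `C` is placed on some of the wires, and on these wires the initial state is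
always a multiple of the initial state of `C` on the input `τ`, then the acceptance probability
is that of `C` on the input `τ`. -/
theorem acceptProb_of_slice {a b : ℕ} (ha : 0 < a) (hb : 0 < b) (C : Circuit G a)
    (D : Circuit G b) (e : Fin (a + C.ancillas) ↪ Fin (b + D.ancillas))
    (he : e ⟨0, Nat.add_pos_left ha _⟩ = ⟨0, Nat.add_pos_left hb _⟩)
    (hD : D.gates = C.gates.map (PlacedGate.map e)) (ψ : State b) (τ : State a) (hψ : ‖ψ‖ = 1)
    (hτ : ‖τ‖ = 1)
    (h : ∀ x, ∃ c : ℂ, slice e x (tens ψ (ket fun _ => false))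
      = c • tens τ (ket fun _ => false)) :
    D.acceptProb ψ = C.acceptProb τ := by
  choose c hc using h
  -- The gates act on each slice separately. The initial norm gives the sum of the squared moduli of
  -- the coefficients `c x`, and the same sum multiplies the acceptance probability of `C` in the
  -- final state.
  have h1 := norm_sq_slice e (tens ψ (ket fun _ => false) : State (b + D.ancillas))
  have h2 := norm_sq_slice e (firstOne (D.run ψ))
  have hrun : D.run ψ = applyGates (C.gates.map (PlacedGate.map e)) (tens ψ (ket fun _ => false)) :=
    by rw [← hD]; rfl
  simp only [hrun, slice_firstOne (Nat.add_pos_left ha _) (Nat.add_pos_left hb _) e he,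
    slice_applyGates, hc, applyGates_smul, firstOne_smul, norm_smul, mul_pow,
    ← Finset.sum_mul] at h2
  simp only [hc, norm_smul, norm_tens, norm_ket, hτ, hψ, mul_one, one_pow] at h1
  rw [h1] at h2
  have := mul_left_cancel₀ (pow_ne_zero _ two_ne_zero) h2
  rw [acceptProb_eq, acceptProb_eq, hrun]
  exact this.symm

end Wires

/-! ### A test for two entangled pairs -/

section Test

/-- The unnormalised state `∑ₚ |p⟩|p⟩` of two pairs of entangled qubits. -/
def pairs : State (2 + 2) :=
  WithLp.toLp 2 fun z => if ∀ i : Fin 2, z (Fin.castAdd 2 i) = z (Fin.natAdd 2 i) then 1 else 0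

/-- The coefficient `∑ₚ ⟨pp|τ⟩`. -/
def pairsCoeff (τ : State (2 + 2)) : ℂ := ∑ p : Fin 2 → Bool, τ (Fin.append p p)

theorem pairs_append (p q : Fin 2 → Bool) : pairs (Fin.append p q) = if p = q then 1 else 0 := by
  simp only [pairs, funext_iff, Fin.append_left, Fin.append_right]

theorem sum_pairs_mul (f : State (2 + 2)) : ∑ z, pairs z * f z = pairsCoeff f := by
  rw [sum_append]
  simp [pairs_append, pairsCoeff]

theorem norm_sq_pairs : ‖pairs‖ ^ 2 = 4 := by
  rw [EuclideanSpace.norm_sq_eq, sum_append]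
  simp only [pairs_append]
  simp [apply_ite norm, ite_pow]

theorem star_pairs (z : Fin (2 + 2) → Bool) : (starRingEnd ℂ) (pairs z) = pairs z := by
  simp only [pairs]
  split_ifs <;> simp

/-- Pythagoras: `pairs` has squared norm 4, so the subtracted vector is the orthogonal projection of
`τ` onto its line. -/
theorem norm_sq_sub_pairs (τ : State (2 + 2)) :
    ‖τ - (pairsCoeff τ / 4) • pairs‖ ^ 2 = ‖τ‖ ^ 2 - ‖pairsCoeff τ‖ ^ 2 / 4 := by
  have h : inner ℂ pairs τ = pairsCoeff τ := by
    rw [PiLp.inner_apply, ← sum_pairs_mul]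
    refine Finset.sum_congr rfl fun z _ => ?_
    rw [RCLike.inner_apply, star_pairs, mul_comm]
  have h' : inner ℂ τ pairs = (starRingEnd ℂ) (pairsCoeff τ) := by
    rw [← h, inner_conj_symm]
  rw [@norm_sub_sq ℂ, inner_smul_right, h', norm_smul, mul_pow, norm_sq_pairs, div_mul_eq_mul_div,
    Complex.mul_conj']
  have : RCLike.re ((‖pairsCoeff τ‖ : ℂ) ^ 2 / 4) = ‖pairsCoeff τ‖ ^ 2 / 4 := by
    have : (‖pairsCoeff τ‖ : ℂ) ^ 2 / 4 = ((‖pairsCoeff τ‖ ^ 2 / 4 : ℝ) : ℂ) := by push_cast; rfl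
    rw [this]
    exact Complex.ofReal_re _
  rw [this, norm_div]
  norm_num
  ring

/-- The coefficient is `∑ₚ u p * v p`, and Cauchy–Schwarz applies. For unit vectors the squared
overlap with the normalised pairs is thus at most `1/4`. -/
theorem norm_pairsCoeff_tens_le (u v : State 2) : ‖pairsCoeff (tens u v)‖ ≤ ‖u‖ * ‖v‖ := by
  simp only [pairsCoeff, tens_append]
  refine (norm_sum_le _ _).trans ?_
  simp only [norm_mul]
  have := Finset.sum_mul_sq_le_sq_mul_sq Finset.univ (fun p => ‖u p‖) fun p => ‖v p‖
  rw [← EuclideanSpace.norm_sq_eq, ← EuclideanSpace.norm_sq_eq, ← mul_pow] at this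
  exact (sq_le_sq₀ (Finset.sum_nonneg fun p _ => by positivity) (by positivity)).1 this

/-- The vector `|0⟩ - |1⟩`. -/
def minus : State 1 := WithLp.toLp 2 fun x => if x 0 = true then -1 else 1

/-- The state `|1⟩` of one qubit. -/
def ketOne : State 1 := ket fun _ => true

/-- The reflection which flips the first qubit if the other ones are two entangled pairs. -/
def flipMatrix : Matrix (Fin (1 + (2 + 2)) → Bool) (Fin (1 + (2 + 2)) → Bool) ℂ :=
  1 - (1 / 4 : ℂ) • Matrix.vecMulVec (tens minus pairs) (tens minus pairs)

theorem sum_fin_one_bool {M : Type} [AddCommMonoid M] (F : (Fin 1 → Bool) → M) :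
    ∑ y, F y = F (fun _ => true) + F (fun _ => false) := by
  rw [← Equiv.sum_comp (Equiv.funUnique (Fin 1) Bool).symm F, Fintype.sum_bool]
  rfl

/-- The vector `tens minus pairs` is real with squared norm `2 * 4 = 8`, so the factor `1/4 = 2/8`
makes this a Householder reflection. -/
theorem flipMatrix_mem : flipMatrix ∈ Matrix.unitaryGroup (Fin (1 + (2 + 2)) → Bool) ℂ := by
  have hs : star (tens minus pairs : (Fin (1 + (2 + 2)) → Bool) → ℂ) = tens minus pairs := by
    funext x
    have : (starRingEnd ℂ) (minus fun i => x (Fin.castAdd (2 + 2) i))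
        = minus fun i => x (Fin.castAdd (2 + 2) i) := by
      simp only [minus]
      split_ifs <;> simp
    simp only [Pi.star_apply, tens, RCLike.star_def, map_mul, star_pairs, this]
  have hd : (tens minus pairs : (Fin (1 + (2 + 2)) → Bool) → ℂ) ⬝ᵥ tens minus pairs = 8 := by
    have h : ∑ z, pairs z * pairs z = 4 := by
      rw [sum_pairs_mul]
      simp [pairsCoeff, pairs_append]
    rw [dotProduct, sum_append]
    simp only [tens_append, sum_fin_one_bool, mul_mul_mul_comm, ← Finset.mul_sum, h]
    simp [minus]
    norm_num
  rw [Matrix.mem_unitaryGroup_iff, Matrix.star_eq_conjTranspose, flipMatrix,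
    Matrix.conjTranspose_sub, Matrix.conjTranspose_smul, Matrix.conjTranspose_one,
    Matrix.conjTranspose_vecMulVec, hs]
  have : star (1 / 4 : ℂ) = 1 / 4 := by simp
  rw [this, sub_mul, mul_sub, mul_sub, Matrix.smul_mul, Matrix.smul_mul, Matrix.mul_smul, Matrix.mul_smul,
    Matrix.vecMulVec_mul_vecMulVec, hd, Matrix.one_mul, Matrix.mul_one, Matrix.one_mul]
  ext i j
  simp [Matrix.vecMulVec_apply]
  ring

theorem flipMatrix_apply (τ : State (2 + 2)) :
    Matrix.toEuclideanLin flipMatrix (tens ketOne τ)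
      = tens ketOne τ + (pairsCoeff τ / 4) • tens minus pairs := by
  have h : ∑ x, (tens minus pairs) x * (tens ketOne τ) x = - pairsCoeff τ := by
    rw [sum_append]
    simp only [tens_append, sum_fin_one_bool, mul_mul_mul_comm, ← Finset.mul_sum, sum_pairs_mul]
    simp [minus, ketOne, ket, funext_iff]
  ext x
  rw [Matrix.toLpLin_apply]
  simp only [flipMatrix, Matrix.sub_mulVec, Matrix.one_mulVec, Matrix.smul_mulVec,
    Matrix.vecMulVec_mulVec]
  have h' : (tens minus pairs : (Fin (1 + (2 + 2)) → Bool) → ℂ) ⬝ᵥ tens ketOne τ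
    = - pairsCoeff τ := h
  simp [h']
  ring

/-- The reflection moves the component of `τ` along `pairs` to first qubit 0; only the orthogonal
remainder keeps first qubit 1. -/
theorem firstOne_flipMatrix_apply (τ : State (2 + 2)) :
    firstOne (Matrix.toEuclideanLin flipMatrix (tens ketOne τ))
      = tens ketOne (τ - (pairsCoeff τ / 4) • pairs) := by
  rw [flipMatrix_apply]
  ext x
  by_cases h : x (Fin.castAdd (2 + 2) 0) = true
  · have : x 0 = true := h
    simp [firstOne, tens, ketOne, ket, minus, this, funext_iff]
    ring
  · have : ¬ x 0 = true := h
    simp [firstOne, tens, ketOne, ket, this, funext_iff]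

variable {G : GateSet}

/-- A circuit which accepts two entangled pairs of qubits with a small probability only, but
products of two states of two qubits with a large probability. -/
theorem exists_pairs_test (hU : G.Universal) : ∃ C : Circuit G (1 + (2 + 2)),
    (∀ τ, ‖τ‖ = 1 → ‖pairsCoeff τ‖ = 2 → C.acceptProb (tens ketOne τ) ≤ 1 / 10000) ∧
    ∀ u v : State 2, ‖u‖ = 1 → ‖v‖ = 1 →
      73 / 100 ≤ C.acceptProb (tens ketOne (tens u v)) := by
  -- An amplitude error of `1/100` turns the ideal probabilities 0 and at least `3/4` into at most
  -- `(1/100)²` and at least `(0.866 - 0.01)² > 0.73`.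
  obtain ⟨C, η, hη, hC⟩ := hU (1 + (2 + 2)) ⟨flipMatrix, flipMatrix_mem⟩ (1 / 100) (by norm_num)
  have h1 : ‖ketOne‖ = 1 := norm_ket _
  have key : ∀ τ : State (2 + 2), ‖τ‖ = 1 →
      |‖firstOne (C.run (tens ketOne τ))‖ - ‖τ - (pairsCoeff τ / 4) • pairs‖| ≤ 1 / 100 := by
    intro τ hτ
    have h := hC (tens ketOne τ) (by rw [norm_tens, h1, hτ, one_mul])
    have h2 : ‖τ - (pairsCoeff τ / 4) • pairs‖
        = ‖firstOne (tens (Matrix.toEuclideanLin flipMatrix (tens ketOne τ)) η)‖ := by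
      rw [firstOne_tens (by norm_num), firstOne_flipMatrix_apply, norm_tens, norm_tens, h1, hη,
        one_mul, mul_one]
    rw [h2]
    refine (abs_norm_sub_norm_le _ _).trans ?_
    rw [← firstOne_sub]
    exact (norm_firstOne_le _).trans h
  refine ⟨C, fun τ hτ h => ?_, fun u v hu hv => ?_⟩
  · have hk := key τ hτ
    have h0 := norm_sq_sub_pairs τ
    rw [hτ, h] at h0
    have h0 : ‖τ - (pairsCoeff τ / 4) • pairs‖ = 0 := by
      rw [← sq_eq_zero_iff, h0]; norm_num
    rw [h0, sub_zero, abs_of_nonneg (norm_nonneg _)] at hk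
    rw [acceptProb_eq]
    nlinarith [norm_nonneg (firstOne (C.run (tens ketOne τ)))]
  · have hτ : ‖tens u v‖ = 1 := by rw [norm_tens, hu, hv, one_mul]
    have hk := (abs_le.1 (key _ hτ)).1
    have h0 := norm_sq_sub_pairs (tens u v)
    have hc := norm_pairsCoeff_tens_le u v
    rw [hu, hv] at hc
    rw [hτ] at h0
    have hc' := norm_nonneg (pairsCoeff (tens u v))
    have h2 : 866 / 1000 ≤ ‖tens u v - (pairsCoeff (tens u v) / 4) • pairs‖ := by
      refine abs_le_of_sq_le_sq' ?_ (norm_nonneg _) |>.2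
      rw [h0]; nlinarith
    rw [acceptProb_eq]
    nlinarith

end Test

/-! ### A uniform family of circuits that test the first four qubits -/

section Tester

/-- The word of `unary (α * a + β)`, with blocks of length `a`. -/
def unaryPattern (α β : ℕ) : List (Option Bool) :=
  List.replicate α none ++ List.replicate β (some true) ++ [some false]

theorem expand_append (a : ℕ) (V W : List (Option Bool)) :
    expand a (V ++ W) = expand a V ++ expand a W :=
  List.flatMap_append

theorem expand_flatten (a : ℕ) (L : List (List (Option Bool))) :
    expand a L.flatten = (L.map (expand a)).flatten := by
  induction L with
  | nil => rfl
  | cons V L ih => rw [List.flatten_cons, expand_append, ih]; rfl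

theorem expand_unaryPattern (a α β : ℕ) : expand a (unaryPattern α β) = unary (α * a + β) := by
  have h1 : expand a (List.replicate α none) = List.replicate (α * a) true := by
    induction α with
    | zero => simp [expand]
    | succ α ih =>
      rw [List.replicate_succ', expand_append, ih, Nat.succ_mul, List.replicate_add]
      simp [expand]
  have h2 : expand a (List.replicate β (some true)) = List.replicate β true := by
    induction β with
    | zero => rfl
    | succ β ih => rw [List.replicate_succ, List.replicate_succ, ← ih]; rfl
  rw [unaryPattern, expand_append, expand_append, h1, h2, unary, List.replicate_add]
  rfl

/-- The number of blocks in the position of wire `i` of the test. -/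
def wireBlocks (i : ℕ) : ℕ := if i = 0 then 0 else if i < 5 then 1 else 2

/-- The constant part of the position of wire `i` of the test. -/
def wireOffset (i : ℕ) : ℕ := if i = 0 then 0 else i + 1

/-- The position of wire `i` of the test: wire `0` is the first wire, the following four
wires are the first four qubits of the state to be tested, the other ones are ancilla qubits. -/
def wirePos (n i : ℕ) : ℕ := wireBlocks i * blockLength n + wireOffset i

theorem wirePos_zero (n : ℕ) : wirePos n 0 = 0 := by
  simp [wirePos, wireBlocks, wireOffset]

theorem wirePos_of_lt (n : ℕ) {i : ℕ} (h : 0 < i) (h' : i < 5) :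
    wirePos n i = blockLength n + i + 1 := by
  simp [wirePos, wireBlocks, wireOffset, h.ne', h', add_assoc]

theorem wirePos_of_le (n : ℕ) {i : ℕ} (h : 5 ≤ i) :
    wirePos n i = 2 * blockLength n + i + 1 := by
  simp [wirePos, wireBlocks, wireOffset, show i ≠ 0 by omega, show ¬ i < 5 by omega, add_assoc]

theorem wirePos_cases (n k : ℕ) : (k = 0 ∧ wirePos n k = 0) ∨
    (0 < k ∧ k < 5 ∧ wirePos n k = blockLength n + k + 1) ∨
    (5 ≤ k ∧ wirePos n k = 2 * blockLength n + k + 1) := by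
  rcases Nat.eq_zero_or_pos k with rfl | h
  · exact Or.inl ⟨rfl, wirePos_zero n⟩
  · rcases Nat.lt_or_ge k 5 with h' | h'
    · exact Or.inr (Or.inl ⟨h, h', wirePos_of_lt n h h'⟩)
    · exact Or.inr (Or.inr ⟨h', wirePos_of_le n h'⟩)

theorem wirePos_strictMono (n : ℕ) : StrictMono (wirePos n) := by
  refine strictMono_nat_of_lt_succ fun i => ?_
  have := wirePos_cases n i
  have := wirePos_cases n (i + 1)
  omega

theorem codeLength_self (n : ℕ) : codeLength n n = blockLength n + 2 := rfl

theorem le_blockLength (n : ℕ) : n ≤ blockLength n := Nat.le_add_left _ _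

/-- The wires of a test with `p` ancilla qubits. -/
def testWires (n p : ℕ) :
    Fin (1 + (2 + 2) + p) ↪ Fin (codeLength n n + n + (blockLength n + (4 + p))) where
  toFun i := ⟨wirePos n i, by
    have := wirePos_cases n i
    have := codeLength_self n
    have := i.2
    omega⟩
  inj' i j h := Fin.ext ((wirePos_strictMono n).injective (congrArg Fin.val h))

variable {G : GateSet}

/-- The circuits that apply `C` to the first qubit and to the first four qubits of the state to be
tested. -/
def tester (C : Circuit G (1 + (2 + 2))) (n : ℕ) : Circuit G (codeLength n n + n) where
  -- All numbers in the description must be affine in `blockLength n` with coefficients independent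
  -- of `n`. The `n` qubits of the tested state would violate this, so the test leaves the first
  -- `blockLength n + 4 - n` ancillas idle and uses the last ones.
  ancillas := blockLength n + (4 + C.ancillas)
  gates := C.gates.map (PlacedGate.map (testWires n C.ancillas))

theorem pUniform_tester (C : Circuit G (1 + (2 + 2))) : PUniform (tester C) := by
  have h : ∀ n, (tester C n).encode = expand (blockLength n) (unaryPattern 1 (4 + C.ancillas) ++
      (C.gates.map fun g => unaryPattern 0 g.gate ++ (List.ofFn fun j =>
        unaryPattern (wireBlocks (g.wires j)) (wireOffset (g.wires j))).flatten).flatten) := by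
    intro n
    rw [expand_append, expand_unaryPattern, expand_flatten, List.map_map, Circuit.encode]
    refine congrArg₂ (· ++ ·) (by rw [one_mul]; rfl) (congrArg List.flatten ?_)
    refine (List.map_map ..).trans ?_
    refine List.map_congr_left fun g _ => ?_
    simp only [Function.comp_apply, expand_append, expand_flatten, expand_unaryPattern,
      List.map_ofFn]
    refine congrArg₂ (· ++ ·) (by rw [zero_mul, zero_add]; rfl) (congrArg List.flatten ?_)
    refine congrArg List.ofFn (funext fun j => ?_)
    exact (expand_unaryPattern _ (wireBlocks (g.wires j)) (wireOffset (g.wires j))).symm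
  have := computable_expand (unaryPattern 1 (4 + C.ancillas) ++
    (C.gates.map fun g => unaryPattern 0 g.gate ++ (List.ofFn fun j =>
        unaryPattern (wireBlocks (g.wires j)) (wireOffset (g.wires j))).flatten).flatten)
  rwa [← funext h] at this

/-- Overwriting the test wires, seen within one register `q`, only overwrites the places `f` of that
register that the test touches. This lets each register be treated separately. -/
theorem extend_comp {u v w t : ℕ} (e : Fin v ↪ Fin w) (q : Fin t → Fin w)
    (f : Fin u ↪ Fin t) (ι : Fin u → Fin v) (h : ∀ i, e (ι i) = q (f i))
    (h' : ∀ k j, e k = q j → ∃ i, f i = j) (y : Fin v → Bool) (x : Fin w → Bool) :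
    (fun j => Function.extend e y x (q j)) = Function.extend f (fun i => y (ι i))
      fun j => x (q j) := by
  funext j
  by_cases hj : ∃ i, f i = j
  · obtain ⟨i, rfl⟩ := hj
    rw [← h, e.injective.extend_apply, f.injective.extend_apply]
  · rw [Function.extend_apply' _ _ _ hj, Function.extend_apply']
    rintro ⟨k, hk⟩
    exact hj (h' k j hk)

theorem ket_apply {w : ℕ} (x y : Fin w → Bool) [Decidable (y = x)] :
    ket x y = if y = x then 1 else 0 := by
  simp [ket]

theorem ket_extend {u t : ℕ} (f : Fin u ↪ Fin t) (a : Fin t → Bool) (x : Fin t → Bool) :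
    ∃ c : ℂ, ∀ y, ket a (Function.extend f y x) = ket (fun i => a (f i)) y * c := by
  classical
  refine ⟨if ∀ j, (¬ ∃ i, f i = j) → x j = a j then 1 else 0, fun y => ?_⟩
  have : Function.extend f y x = a ↔ y = (fun i => a (f i)) ∧
      ∀ j, (¬ ∃ i, f i = j) → x j = a j := by
    constructor
    · rintro rfl
      refine ⟨funext fun i => (f.injective.extend_apply _ _ _).symm, fun j hj => ?_⟩
      rw [Function.extend_apply' _ _ _ hj]
    · rintro ⟨rfl, h⟩
      funext j
      by_cases hj : ∃ i, f i = j
      · obtain ⟨i, rfl⟩ := hj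
        rw [f.injective.extend_apply]
      · rw [Function.extend_apply' _ _ _ hj, h j hj]
  rw [ket_apply, ket_apply, if_congr this rfl rfl, ite_and]
  split_ifs <;> simp

/-- The values of `σ` are encoded starting from 1, so the first unary block is never empty. Hence
the output wire starts in `|1⟩`, as the test requires. -/
theorem getD_code_zero {n : ℕ} (hn : 0 < n) (σ : Equiv.Perm (Fin n)) (m : Composition n) :
    (code σ m).getD 0 false = true := by
  obtain ⟨n, rfl⟩ := Nat.exists_eq_succ_of_ne_zero hn.ne'
  simp [code, List.ofFn_succ, unary, List.replicate_succ]

/-- If the first four qubits of `φ` are in the state `τ`, then the tester accepts `φ` with the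
probability with which `C` accepts `τ`. -/
theorem acceptProb_tester (C : Circuit G (1 + (2 + 2))) {n : ℕ} (hn : 2 + 2 ≤ n)
    (φ : Qustring n) (σ : Equiv.Perm (Fin n)) (m : Composition n) (τ : State (2 + 2))
    (hτ : ‖τ‖ = 1) (r : (Fin n → Bool) → ℂ)
    (hr : ∀ z z' : Fin n → Bool, (∀ i : Fin n, 4 ≤ (i : ℕ) → z i = z' i) → r z = r z')
    (hφ : ∀ z, φ.1 z = τ (fun i => z (Fin.castLE hn i)) * r z) :
    (tester C n).acceptProb (codedInput n σ m φ) = C.acceptProb (tens ketOne τ) := by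
  have hk : ‖ketOne‖ = 1 := norm_ket _
  have hA := le_blockLength n
  have hL := codeLength_self n
  refine acceptProb_of_slice (by norm_num) (by omega) C (tester C n) (testWires n C.ancillas)
    (Fin.ext (wirePos_zero n)) rfl _ _ ?_ ?_ fun x => ?_
  · rw [codedInput, norm_tens, norm_ket, φ.2, one_mul]
  · rw [norm_tens, hk, hτ, one_mul]
  -- There are three registers: code, tested state and ancillas. Each `q` below places a register
  -- among all wires, and each `f` selects the part of it used by the test; in each register this
  -- part is in a product state with the rest.
  let f₁ : Fin 1 ↪ Fin (codeLength n n) := Fin.castLEEmb (by omega)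
  let f₂ : Fin (2 + 2) ↪ Fin n := Fin.castLEEmb hn
  let f₃ : Fin C.ancillas ↪ Fin (blockLength n + (4 + C.ancillas)) :=
    ⟨fun j => ⟨blockLength n + 4 - n + j, by omega⟩, fun i j h => by
      have := congrArg Fin.val h
      exact Fin.ext (by simpa using this)⟩
  let q₁ : Fin (codeLength n n) → Fin (codeLength n n + n + (blockLength n + (4 + C.ancillas))) :=
    fun i => Fin.castAdd _ (Fin.castAdd n i)
  let q₂ : Fin n → Fin (codeLength n n + n + (blockLength n + (4 + C.ancillas))) :=
    fun i => Fin.castAdd _ (Fin.natAdd _ i)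
  let q₃ : Fin (blockLength n + (4 + C.ancillas)) →
      Fin (codeLength n n + n + (blockLength n + (4 + C.ancillas))) := fun i => Fin.natAdd _ i
  have hpos := fun k : Fin (1 + (2 + 2) + C.ancillas) => wirePos_cases n k
  have e₁ := fun y => extend_comp (testWires n C.ancillas) q₁ f₁
    (fun i => Fin.castAdd _ (Fin.castAdd _ i))
    (fun i => Fin.ext (by
      have : (i : ℕ) = 0 := by omega
      change wirePos n i = i
      rw [this, wirePos_zero]))
    (fun k j h => ⟨0, Fin.ext (by
      have h : wirePos n k = j := congrArg Fin.val h
      have := hpos k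
      have := j.2
      simp only [f₁, Fin.castLEEmb_apply, Fin.val_castLE, Fin.val_zero]
      omega)⟩) y x
  have e₂ := fun y => extend_comp (testWires n C.ancillas) q₂ f₂
    (fun i => Fin.castAdd _ (Fin.natAdd _ i))
    (fun i => Fin.ext (by
      have : wirePos n (1 + i) = blockLength n + (1 + i) + 1 :=
        wirePos_of_lt n (by omega) (by omega)
      change wirePos n (1 + i) = codeLength n n + i
      omega))
    (fun k j h => by
      have h : wirePos n k = codeLength n n + j := congrArg Fin.val h
      have := hpos k
      have := j.2
      exact ⟨⟨j, by omega⟩, rfl⟩) y x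
  have e₃ := fun y => extend_comp (testWires n C.ancillas) q₃ f₃
    (fun i => Fin.natAdd _ i)
    (fun i => Fin.ext (by
      have : wirePos n (1 + (2 + 2) + i) = 2 * blockLength n + (1 + (2 + 2) + i) + 1 :=
        wirePos_of_le n (by omega)
      change wirePos n (1 + (2 + 2) + i)
        = codeLength n n + n + (blockLength n + 4 - n + i)
      omega))
    (fun k j h => by
      have h : wirePos n k = codeLength n n + n + j := congrArg Fin.val h
      have := hpos k
      have := j.2
      have := k.2
      exact ⟨⟨j - (blockLength n + 4 - n), by omega⟩, Fin.ext (by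
        change blockLength n + 4 - n + (j - (blockLength n + 4 - n)) = (j : ℕ)
        omega)⟩) y x
  obtain ⟨c₁, h₁⟩ := ket_extend f₁ (fun i => (code σ m).getD i false) fun j => x (q₁ j)
  obtain ⟨c₃, h₃⟩ := ket_extend f₃ (fun _ => false) fun j => x (q₃ j)
  refine ⟨c₁ * r (fun j => x (q₂ j)) * c₃, ?_⟩
  ext y
  have g₁ : (fun i : Fin 1 => (code σ m).getD (f₁ i) false) = fun _ => true := by
    funext i
    have : ((f₁ i : Fin _) : ℕ) = 0 := by simp [f₁]
    rw [this, getD_code_zero (by omega)]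
  have g₂ : φ.1 (Function.extend f₂ (fun i => y (Fin.castAdd _ (Fin.natAdd _ i)))
      fun j => x (q₂ j)) = τ (fun i => y (Fin.castAdd _ (Fin.natAdd _ i)))
        * r (fun j => x (q₂ j)) := by
    rw [hφ]
    refine congrArg₂ (· * ·) (congrArg τ (funext fun i => ?_)) (hr _ _ fun i hi => ?_)
    · exact f₂.injective.extend_apply _ _ _
    · refine Function.extend_apply' _ _ _ ?_
      rintro ⟨j, rfl⟩
      have := j.2
      simp only [f₂, Fin.castLEEmb_apply, Fin.val_castLE] at hi
      omega
  have key : slice (testWires n C.ancillas) x (tens (codedInput n σ m φ) (ket fun _ => false)) y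
      = ket (fun i : Fin (codeLength n n) => (code σ m).getD i false)
          (fun i => Function.extend (testWires n C.ancillas) y x (q₁ i))
        * φ.1 (fun i => Function.extend (testWires n C.ancillas) y x (q₂ i))
        * ket (fun _ => false)
          (fun i => Function.extend (testWires n C.ancillas) y x (q₃ i)) := rfl
  refine key.trans ?_
  rw [e₁, e₂, e₃, h₁, h₃, g₁, g₂]
  simp only [tens, PiLp.smul_apply, smul_eq_mul, ketOne]
  ring

end Tester

/-! ### Ensembles that are not approximable -/

section NotApproximable

/-! ### A lower bound for the trace norm. -/

section TraceNorm

open scoped MatrixOrder ComplexOrder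

/-- With `M = N* N` the left side is the squared norm of `N ξ` and the right side is the squared
Frobenius norm of `N`. -/
theorem quadratic_le_trace {ι : Type} [Fintype ι] [DecidableEq ι] {M : Matrix ι ι ℂ}
    (hM : M.PosSemidef) (ξ : EuclideanSpace ℂ ι) (hξ : ‖ξ‖ = 1) :
    (star (ξ : ι → ℂ) ⬝ᵥ M.mulVec ξ).re ≤ M.trace.re := by
  obtain ⟨N, rfl⟩ := CStarAlgebra.nonneg_iff_eq_star_mul_self.1 hM.nonneg
  rw [Matrix.star_eq_conjTranspose]
  have h1 : star (ξ : ι → ℂ) ⬝ᵥ (N.conjTranspose * N).mulVec ξ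
      = ((∑ i, ‖N.mulVec ξ i‖ ^ 2 : ℝ) : ℂ) := by
    rw [← Matrix.mulVec_mulVec, Matrix.dotProduct_mulVec, ← Matrix.star_mulVec]
    simp [dotProduct, Complex.conj_mul']
  have h2 : (N.conjTranspose * N).trace = ((∑ i, ∑ j, ‖N i j‖ ^ 2 : ℝ) : ℂ) := by
    rw [Matrix.trace, Finset.sum_comm]
    simp [Matrix.mul_apply, Complex.conj_mul']
  rw [h1, h2, Complex.ofReal_re, Complex.ofReal_re]
  refine Finset.sum_le_sum fun i _ => ?_
  have h3 : ‖N.mulVec ξ i‖ ≤ ∑ j, ‖N i j‖ * ‖ξ j‖ := by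
    refine (norm_sum_le _ _).trans (le_of_eq ?_)
    simp only [norm_mul]
  have h4 := Finset.sum_mul_sq_le_sq_mul_sq Finset.univ (fun j => ‖N i j‖) fun j => ‖ξ j‖
  rw [← EuclideanSpace.norm_sq_eq, hξ, one_pow, mul_one] at h4
  exact (pow_le_pow_left₀ (norm_nonneg _) h3 2).trans h4

/-- Both `|X| - X` and `|X| + X` are positive. As `X` has trace zero, the trace of the first is
twice the trace norm and bounds its quadratic form; positivity of the second replaces `|X|` there by
`-X`. -/
theorem neg_quadratic_le_trNorm {ι : Type} [Fintype ι] [DecidableEq ι] {X : Matrix ι ι ℂ}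
    (hX : X.IsHermitian) (h0 : X.trace.re = 0) (ξ : EuclideanSpace ℂ ι) (hξ : ‖ξ‖ = 1) :
    - (star (ξ : ι → ℂ) ⬝ᵥ X.mulVec ξ).re ≤ trNorm X := by
  have hs : IsSelfAdjoint X := hX
  have h1 : (CFC.abs X - X).PosSemidef := by
    rw [← Matrix.nonneg_iff_posSemidef, CFC.abs_sub_self X hs]
    exact nsmul_nonneg (CFC.negPart_nonneg X) 2
  have h2 : (CFC.abs X + X).PosSemidef := by
    rw [← Matrix.nonneg_iff_posSemidef, CFC.abs_add_self X hs]
    exact nsmul_nonneg (CFC.posPart_nonneg X) 2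
  have h3 := quadratic_le_trace h1 ξ hξ
  have h4 := (Complex.le_def.1 (h2.dotProduct_mulVec_nonneg (ξ : ι → ℂ))).1
  have h5 : trNorm X = (CFC.abs X).trace.re / 2 := rfl
  rw [Matrix.trace_sub, Complex.sub_re, h0, Matrix.sub_mulVec, dotProduct_sub,
    Complex.sub_re] at h3
  rw [Matrix.add_mulVec, dotProduct_add, Complex.add_re, Complex.zero_re] at h4
  rw [h5]
  linarith

end TraceNorm

theorem isHermitian_density {w : ℕ} (ψ : State w) : (density ψ).IsHermitian := by
  ext x y
  simp [density, mul_comm]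

theorem trace_density {w : ℕ} (ψ : State w) : (density ψ).trace = (‖ψ‖ ^ 2 : ℝ) := by
  rw [EuclideanSpace.norm_sq_eq]
  simp [Matrix.trace, density, Complex.mul_conj']

theorem quadratic_density {w : ℕ} (ψ ξ : State w) :
    star (ξ : (Fin w → Bool) → ℂ) ⬝ᵥ (density ψ).mulVec ξ = (‖inner ℂ ξ ψ‖ ^ 2 : ℝ) := by
  have h1 : inner ℂ ξ ψ = ∑ x, ψ x * star (ξ x) := by
    simp [PiLp.inner_apply]
  have h2 : star (inner ℂ ξ ψ) = ∑ y, star (ψ y) * ξ y := by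
    rw [h1, star_sum]
    simp
  have h3 : ((‖inner ℂ ξ ψ‖ ^ 2 : ℝ) : ℂ) = inner ℂ ξ ψ * star (inner ℂ ξ ψ) := by
    rw [Complex.ofReal_pow]
    exact (Complex.mul_conj' _).symm
  rw [h3, h2, h1, Finset.sum_mul]
  refine Finset.sum_congr rfl fun x _ => ?_
  simp only [Matrix.mulVec, dotProduct, density, Pi.star_apply, Finset.mul_sum]
  exact Finset.sum_congr rfl fun y _ => by ring

/-- The state of the first qubits after the last ones have been measured as `z`. -/
def branch {a p : ℕ} (Ψ : State (a + p)) (z : Fin p → Bool) : State a :=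
  WithLp.toLp 2 fun x => Ψ (Fin.append x z)

theorem traceOut_density {a p : ℕ} (Ψ : State (a + p)) :
    traceOut (density Ψ) = ∑ z, density (branch Ψ z) := by
  ext x y
  simp [traceOut, density, branch, Matrix.sum_apply]

theorem sum_norm_sq_branch {a p : ℕ} (Ψ : State (a + p)) :
    ∑ z, ‖branch Ψ z‖ ^ 2 = ‖Ψ‖ ^ 2 := by
  simp only [EuclideanSpace.norm_sq_eq]
  rw [sum_append, Finset.sum_comm]
  rfl

/-- A state cannot be approximated by a mixed state which has a small fidelity with it. -/
theorem le_trNorm_sub {a p : ℕ} (Ψ : State (a + p)) (hΨ : ‖Ψ‖ = 1) (ξ : State a)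
    (hξ : ‖ξ‖ = 1) :
    1 - ∑ z, ‖inner ℂ ξ (branch Ψ z)‖ ^ 2 ≤ trNorm (traceOut (density Ψ) - density ξ) := by
  have h := neg_quadratic_le_trNorm (X := traceOut (density Ψ) - density ξ) ?_ ?_ ξ hξ
  · refine le_trans (le_of_eq ?_) h
    rw [traceOut_density, Matrix.sub_mulVec, dotProduct_sub, Matrix.sum_mulVec, dotProduct_sum,
      quadratic_density]
    simp only [quadratic_density]
    rw [inner_self_eq_norm_sq_to_K, hξ, ← Complex.ofReal_sum, Complex.sub_re, Complex.ofReal_re,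
      Complex.ofReal_re]
    simp
  · refine Matrix.IsHermitian.sub ?_ (isHermitian_density ξ)
    rw [traceOut_density, Matrix.IsHermitian, Matrix.conjTranspose_sum]
    exact Finset.sum_congr rfl fun z _ => isHermitian_density _
  · rw [traceOut_density, Matrix.trace_sub, Matrix.trace_sum, trace_density]
    simp only [trace_density]
    rw [← Complex.ofReal_sum, sum_norm_sq_branch, hΨ, hξ]
    simp

/-- One of four orthonormal states is far from a given mixed state. -/
theorem exists_far {a p : ℕ} (Ψ : State (a + p)) (hΨ : ‖Ψ‖ = 1) (ξ : Fin 4 → State a)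
    (hξ : Orthonormal ℂ ξ) :
    ∃ c, 3 / 4 ≤ trNorm (traceOut (density Ψ) - density (ξ c)) := by
  -- Bessel's inequality on each branch: the four fidelities sum to at most 1, so one is at most
  -- `1/4`.
  have h : ∑ c, ∑ z, ‖inner ℂ (ξ c) (branch Ψ z)‖ ^ 2 ≤ ∑ _c : Fin 4, (1 / 4 : ℝ) := by
    rw [Finset.sum_comm]
    refine (Finset.sum_le_sum fun z _ => hξ.sum_inner_products_le (branch Ψ z)).trans ?_
    rw [sum_norm_sq_branch, hΨ]
    norm_num
  obtain ⟨c, -, hc⟩ := Finset.exists_le_of_sum_le Finset.univ_nonempty h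
  refine ⟨c, le_trans ?_ (le_trNorm_sub Ψ hΨ (ξ c) (hξ.1 c))⟩
  linarith

/-! ### Unique readability of circuit descriptions, and the diagonal argument. -/

theorem unary_append_inj {a b : ℕ} {l l' : List Bool} (h : unary a ++ l = unary b ++ l') :
    a = b ∧ l = l' := by
  induction a generalizing b with
  | zero =>
    cases b with
    | zero => simpa [unary] using h
    | succ b => simp [unary, List.replicate_succ] at h
  | succ a ih =>
    cases b with
    | zero => simp [unary, List.replicate_succ] at h
    | succ b =>
      have := ih (b := b) (by simpa [unary, List.replicate_succ] using h)
      exact ⟨by rw [this.1], this.2⟩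

theorem flatten_ofFn_unary_inj {k : ℕ} {f g : Fin k → ℕ} {l l' : List Bool}
    (h : (List.ofFn fun j => unary (f j)).flatten ++ l
      = (List.ofFn fun j => unary (g j)).flatten ++ l') : f = g ∧ l = l' := by
  induction k generalizing l l' with
  | zero => exact ⟨Subsingleton.elim _ _, by simpa using h⟩
  | succ k ih =>
    rw [List.ofFn_succ, List.ofFn_succ, List.flatten_cons, List.flatten_cons, List.append_assoc,
      List.append_assoc] at h
    obtain ⟨h0, h⟩ := unary_append_inj h
    obtain ⟨h1, h⟩ := ih h
    refine ⟨funext fun j => ?_, h⟩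
    refine Fin.cases h0 (fun i => congrFun h1 i) j

variable {G : GateSet}

/-- The gate number is read first and fixes the arity, hence how many wire numbers follow. -/
theorem PlacedGate.encode_append_inj {w : ℕ} {g g' : PlacedGate G w} {l l' : List Bool}
    (h : g.encode ++ l = g'.encode ++ l') : g = g' ∧ l = l' := by
  obtain ⟨i, e⟩ := g
  obtain ⟨i', e'⟩ := g'
  rw [PlacedGate.encode, PlacedGate.encode, List.append_assoc, List.append_assoc] at h
  obtain ⟨hi, h⟩ := unary_append_inj h
  obtain rfl : i = i' := Fin.ext hi
  obtain ⟨he, h⟩ := flatten_ofFn_unary_inj (f := fun j => (e j : ℕ)) (g := fun j => (e' j : ℕ)) h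
  refine ⟨?_, h⟩
  congr 1
  ext j
  exact congrFun he j

theorem PlacedGate.encode_ne_nil {w : ℕ} (g : PlacedGate G w) : g.encode ≠ [] := by
  simp [PlacedGate.encode, unary]

theorem Circuit.encode_injective {a : ℕ} : (Circuit.encode : Circuit G a → List Bool).Injective := by
  rintro ⟨p, L⟩ ⟨p', L'⟩ h
  obtain ⟨hp, hL⟩ := unary_append_inj h
  clear h
  change p = p' at hp
  subst hp
  congr 1
  replace hL : (L.map PlacedGate.encode).flatten = (L'.map PlacedGate.encode).flatten := hL
  induction L generalizing L' with
  | nil =>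
    cases L' with
    | nil => rfl
    | cons g L' =>
      simp [PlacedGate.encode_ne_nil] at hL
  | cons g L ih =>
    cases L' with
    | nil => simp [PlacedGate.encode_ne_nil] at hL
    | cons g' L' =>
      rw [List.map_cons, List.map_cons, List.flatten_cons, List.flatten_cons] at hL
      obtain ⟨rfl, hL'⟩ := PlacedGate.encode_append_inj hL
      rw [ih _ hL']

/-- Among the ensembles that are built from four orthonormal states of every large length, there
is one that is not uniformly approximable. -/
theorem exists_not_uniformlyApproximable (G : GateSet) (ξ : ∀ n, Fin 4 → Qustring n) (N : ℕ)
    (hξ : ∀ n, N ≤ n → Orthonormal ℂ fun c => (ξ n c).1) {ε : ℝ} (hε : ε < 3 / 4) :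
    ∃ c : ℕ → Fin 4, ∀ s, ¬ UniformlyApproximable G (ℓ := fun n => n) (fun _ => ε) s
      fun n => ξ n (c n) := by
  classical
  obtain ⟨f, hf⟩ := countable_computable.exists_eq_range
    ⟨_, computable_expand []⟩
  -- Length `n` is devoted to the function numbered `n.unpair.1`. Its value at `n` describes at most
  -- one circuit, so a single choice of `c` suffices.
  have hc : ∀ n, ∃ c : Fin 4, N ≤ n → ∀ C : Circuit G n, C.encode = f n.unpair.1 n →
      3 / 4 ≤ trNorm (traceOut (density (C.run (ket fun _ => false))) - density (ξ n c).1) := by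
    intro n
    by_cases h : ∃ C : Circuit G n, C.encode = f n.unpair.1 n ∧ N ≤ n
    · obtain ⟨C, hC, hn⟩ := h
      have h1 : ‖C.run (ket fun _ => false)‖ = 1 := by
        refine (norm_applyGates C.gates _).trans ?_
        rw [norm_tens, norm_ket, norm_ket, one_mul]
      obtain ⟨c, hc⟩ := exists_far _ h1 _ (hξ n hn)
      refine ⟨c, fun _ C' hC' => ?_⟩
      obtain rfl := Circuit.encode_injective (hC'.trans hC.symm)
      exact hc
    · exact ⟨0, fun hn C hC => absurd ⟨C, hC, hn⟩ h⟩
  choose c hc using hc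
  refine ⟨c, fun s => ?_⟩
  rintro ⟨C, hC, -, hev⟩
  obtain ⟨i, hi⟩ : (fun n => (C n).encode) ∈ Set.range f := by
    rw [← hf]
    exact hC
  obtain ⟨M, hM⟩ := Filter.eventually_atTop.1 hev
  -- Function `i` is treated at all lengths `Nat.pair i j`, in particular at one beyond both
  -- thresholds.
  have hle : max M N ≤ Nat.pair i (max M N) := Nat.right_le_pair _ _
  have h1 := hM (Nat.pair i (max M N)) ((le_max_left _ _).trans hle)
  have h2 := hc (Nat.pair i (max M N)) ((le_max_right _ _).trans hle) (C _) (by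
    rw [Nat.unpair_pair]
    exact (congrFun hi _).symm)
  linarith

end NotApproximable

/-! ### Product states and the ensemble -/

section Ensemble

/-- The product of the states `a i` of single qubits. -/
def prodState {w : ℕ} (a : Fin w → Bool → ℂ) : State w := WithLp.toLp 2 fun x => ∏ i, a i (x i)

theorem norm_prodState {w : ℕ} {a : Fin w → Bool → ℂ} (ha : ∀ i, ∑ b, ‖a i b‖ ^ 2 = 1) :
    ‖prodState a‖ = 1 := by
  have : ‖prodState a‖ ^ 2 = 1 := by
    rw [EuclideanSpace.norm_sq_eq]
    simp only [prodState, norm_prod, ← Finset.prod_pow]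
    rw [← Fintype.piFinset_univ, ← Finset.prod_univ_sum (fun _ => Finset.univ)
      fun i b => ‖a i b‖ ^ 2]
    exact Finset.prod_eq_one fun i _ => ha i
  exact (pow_eq_one_iff_of_nonneg (norm_nonneg _) two_ne_zero).1 this

theorem prodState_add {u w : ℕ} (a : Fin (u + w) → Bool → ℂ) :
    prodState a = tens (prodState fun i => a (Fin.castAdd w i))
      (prodState fun i => a (Fin.natAdd u i)) := by
  ext x
  exact Fin.prod_univ_add _

theorem sum_norm_sq_of_eq_one {w : ℕ} (hw : w = 1) (ψ : Qustring w) :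
    ∑ b, ‖ψ.1 fun _ => b‖ ^ 2 = 1 := by
  subst hw
  have h : ‖ψ.1‖ ^ 2 = 1 := by rw [ψ.2, one_pow]
  rw [EuclideanSpace.norm_sq_eq, sum_fin_one_bool] at h
  rw [Fintype.sum_bool]
  exact h

/-- A separable state with `n` factors is a product of states of single qubits. -/
theorem Achieves.exists_eq_prodState {n : ℕ} {σ : Equiv.Perm (Fin n)} {m : Composition n}
    {φ : State n} (h : Achieves σ m φ) (hm : m.length = n) :
    ∃ a : Fin n → Bool → ℂ, (∀ i, ∑ b, ‖a i b‖ ^ 2 = 1) ∧ φ = prodState a := by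
  -- With `n` blocks every block has length one, so `σ` merely relabels the single-qubit factors.
  obtain rfl := Composition.eq_ones_iff_length.2 hm
  obtain ⟨ψ, hψ⟩ := h
  have hb : ∀ i, (Composition.ones n).blocksFun i = 1 := fun i => Composition.ones_blocksFun n i
  let e : Fin (Composition.ones n).length ≃ Fin n := finCongr hm
  have hemb : ∀ i j, (Composition.ones n).embedding i j = e i := by
    intro i j
    have hj : (j : ℕ) = 0 := by
      have := j.2.trans_eq (hb i)
      omega
    refine Fin.ext ?_
    rw [Composition.coe_embedding, Composition.ones_sizeUpTo, hj, add_zero]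
    exact min_eq_left (i.2.trans_eq hm).le
  refine ⟨fun k b => (ψ (e.symm (σ⁻¹ k))).1 fun _ => b,
    fun k => sum_norm_sq_of_eq_one (hb _) _, ?_⟩
  ext z
  have h1 : permute σ φ (fun i => z (σ i)) = φ z := by
    refine congrArg φ (funext fun i => ?_)
    simp
  rw [← h1, hψ]
  simp only [hemb]
  refine (Equiv.prod_comp (e.trans σ) _).symm.trans ?_ |>.symm
  refine Finset.prod_congr rfl fun i _ => ?_
  have h2 : e.symm (σ⁻¹ ((e.trans σ) i)) = i := by simp
  change (ψ (e.symm (σ⁻¹ ((e.trans σ) i)))).1 (fun _ => z (σ (e i))) = _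
  rw [h2]

theorem prodState_swap {w : ℕ} (a : Fin w → Bool → ℂ) (x y : Fin w → Bool) (i : Fin w) :
    prodState a x * prodState a y
      = prodState a (Function.update x i (y i)) * prodState a (Function.update y i (x i)) := by
  simp only [prodState, ← Finset.prod_mul_distrib]
  refine Finset.prod_congr rfl fun j _ => ?_
  by_cases h : j = i
  · subst h
    simp [mul_comm]
  · simp [h]

/-- Two strings in the support of `φ` exist such that copying a bit from one to the other leaves
the support. -/
def SwapBreaks {n : ℕ} (φ : State n) : Prop :=
  ∃ x y i, φ x ≠ 0 ∧ φ y ≠ 0 ∧ φ (Function.update x i (y i)) = 0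

/-- For a product state, exchanging one bit between two strings preserves the product of their
amplitudes (`prodState_swap`), so `n` factors are impossible here. -/
theorem SwapBreaks.partiallyEntangled {n : ℕ} {φ : Qustring n} (h : SwapBreaks φ.1) :
    PartiallyEntangled φ := by
  obtain ⟨x, y, i, hx, hy, h0⟩ := h
  have hn : 0 < n := i.pos
  have : sind φ ≤ n - 1 := by
    refine csSup_le' ?_
    rintro k ⟨-, hk, σ, m, hm, hach⟩
    by_contra hlt
    obtain rfl : k = n := by omega
    obtain ⟨a, -, ha⟩ := hach.exists_eq_prodState hm
    have := prodState_swap a x y i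
    rw [← ha, h0, zero_mul] at this
    exact mul_ne_zero hx hy this
  rw [PartiallyEntangled]
  omega

theorem exists_swapBreaks {n : ℕ} (hn : 2 ≤ n) : ∃ φ : Qustring n, SwapBreaks φ.1 := by
  -- The unnormalised GHZ state: copying one bit between its two strings gives a mixed string.
  let v : State n := ket (fun _ => false) + ket fun _ => true
  have h01 : (fun _ : Fin n => false) ≠ fun _ => true := fun h =>
    Bool.false_ne_true (congrFun h ⟨0, by omega⟩)
  have h0 : v (fun _ => false) = 1 := by simp [v, ket_apply, h01]
  have h1 : v (fun _ => true) = 1 := by simp [v, ket_apply, h01.symm]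
  have h2 : v (Function.update (fun _ => false) ⟨0, by omega⟩ true) = 0 := by
    have e1 : Function.update (fun _ : Fin n => false) ⟨0, by omega⟩ true ≠ fun _ => false :=
      fun h => by simpa using congrFun h ⟨0, by omega⟩
    have e2 : Function.update (fun _ : Fin n => false) ⟨0, by omega⟩ true ≠ fun _ => true :=
      fun h => by simpa [Function.update_apply, Fin.ext_iff] using congrFun h ⟨1, by omega⟩
    simp [v, ket_apply, e1, e2]
  have hv : ‖v‖ ≠ 0 := by
    rw [norm_ne_zero_iff]
    intro h
    rw [h] at h0
    simp at h0
  refine ⟨⟨(‖v‖⁻¹ : ℂ) • v, ?_⟩, fun _ => false, fun _ => true, ⟨0, by omega⟩, ?_, ?_, ?_⟩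
  · rw [norm_smul, norm_inv, Complex.norm_real, norm_norm, inv_mul_cancel₀ hv]
  · simpa [h0] using hv
  · simpa [h1] using hv
  · simp [h2]

theorem inner_tens {a b : ℕ} (ψ ψ' : State a) (η η' : State b) :
    inner ℂ (tens ψ η) (tens ψ' η') = inner ℂ ψ ψ' * inner ℂ η η' := by
  simp only [PiLp.inner_apply]
  rw [sum_append, Finset.sum_mul_sum]
  refine Finset.sum_congr rfl fun y _ => Finset.sum_congr rfl fun z _ => ?_
  simp only [tens_append, RCLike.inner_apply, map_mul]
  ring

/-- Two entangled pairs. -/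
def normalizedPairs : State (2 + 2) := (1 / 2 : ℂ) • pairs

theorem norm_normalizedPairs : ‖normalizedPairs‖ = 1 := by
  have : ‖pairs‖ = 2 := by
    rw [← sq_eq_sq₀ (norm_nonneg _) zero_le_two, norm_sq_pairs]
    norm_num
  rw [normalizedPairs, norm_smul, this]
  norm_num

theorem norm_pairsCoeff_normalizedPairs : ‖pairsCoeff normalizedPairs‖ = 2 := by
  simp [pairsCoeff, normalizedPairs, pairs_append]
  norm_num

/-- The first four qubits of `φ` are two entangled pairs, and are not entangled with the
others. -/
def StartsWithPairs {n : ℕ} (hn : 2 + 2 ≤ n) (φ : State n) : Prop :=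
  ∃ r : (Fin n → Bool) → ℂ,
    (∀ z z' : Fin n → Bool, (∀ i : Fin n, 4 ≤ (i : ℕ) → z i = z' i) → r z = r z') ∧
    ∀ z, φ z = normalizedPairs (fun i => z (Fin.castLE hn i)) * r z

theorem StartsWithPairs.swapBreaks {n : ℕ} {hn : 2 + 2 ≤ n} {φ : State n}
    (h : StartsWithPairs hn φ) (h0 : φ ≠ 0) : SwapBreaks φ := by
  obtain ⟨r, hr, hφ⟩ := h
  obtain ⟨z, hz⟩ : ∃ z, φ z ≠ 0 := by
    by_contra! hall
    exact h0 (by ext z; exact hall z)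
  have hrz : r z ≠ 0 := fun h => hz (by rw [hφ, h, mul_zero])
  let f : Fin (2 + 2) ↪ Fin n := Fin.castLEEmb hn
  have key : ∀ p : Fin (2 + 2) → Bool, φ (Function.extend f p z) = normalizedPairs p * r z := by
    intro p
    rw [hφ]
    refine congrArg₂ (· * ·) (congrArg _ (funext fun i => f.injective.extend_apply _ _ _))
      (hr _ _ fun i hi => Function.extend_apply' _ _ _ ?_)
    rintro ⟨j, rfl⟩
    have := j.2
    simp only [f, Fin.castLEEmb_apply, Fin.val_castLE] at hi
    omega
  have hup : ∀ p : Fin (2 + 2) → Bool, ∀ i b, Function.update (Function.extend f p z) (f i) b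
      = Function.extend f (Function.update p i b) z := by
    intro p i b
    funext j
    by_cases hj : ∃ k, f k = j
    · obtain ⟨k, rfl⟩ := hj
      rw [f.injective.extend_apply]
      by_cases hk : k = i
      · subst hk; simp
      · rw [Function.update_of_ne (f.injective.ne hk), Function.update_of_ne hk,
          f.injective.extend_apply]
    · rw [Function.extend_apply' _ _ _ hj, Function.update_of_ne, Function.extend_apply' _ _ _ hj]
      rintro rfl
      exact hj ⟨i, rfl⟩
  -- The strings `0000` and `1010` lie in the support of the pairs; copying the first bit of the
  -- second into the first gives `1000`, which does not.
  let u : Fin 2 → Bool := fun i => decide (i = 0)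
  refine ⟨Function.extend f (fun _ => false) z, Function.extend f (Fin.append u u) z, f 0,
    ?_, ?_, ?_⟩
  · rw [key]
    refine mul_ne_zero ?_ hrz
    simp [normalizedPairs, pairs]
  · rw [key]
    refine mul_ne_zero ?_ hrz
    simp [normalizedPairs, pairs_append]
  · rw [f.injective.extend_apply, hup, key]
    have : Fin.append u u 0 = true := rfl
    rw [this]
    have : pairs (Function.update (fun _ => false) 0 true) = 0 := by
      have e : Function.update (fun _ : Fin (2 + 2) => false) 0 true
          = Fin.append u fun _ => false := by
        funext i
        fin_cases i <;> rfl
      have hu : u ≠ fun _ => false := fun h => by simpa [u] using congrFun h 0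
      rw [e, pairs_append, if_neg hu]
    rw [normalizedPairs, PiLp.smul_apply, this, smul_zero, zero_mul]

theorem exists_orthonormal_startsWithPairs {n : ℕ} (hn : 6 ≤ n) : ∃ ξ : Fin 4 → Qustring n,
    Orthonormal ℂ (fun c => (ξ c).1) ∧ ∀ c, StartsWithPairs (by omega) (ξ c).1 := by
  obtain ⟨k, rfl⟩ := Nat.exists_eq_add_of_le (show 2 + 2 ≤ n by omega)
  -- Four orthonormal basis states need two qubits besides the pairs, hence `n ≥ 6`.
  obtain ⟨b⟩ : Nonempty (Fin 4 ↪ (Fin k → Bool)) := by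
    refine Function.Embedding.nonempty_of_card_le ?_
    simp only [Fintype.card_fin, Fintype.card_pi, Fintype.card_bool, Finset.prod_const,
      Finset.card_univ]
    exact Nat.pow_le_pow_right two_pos (show 2 ≤ k by omega)
  refine ⟨fun c => ⟨tens normalizedPairs (ket (b c)), ?_⟩, ⟨fun c => ?_, fun c c' h => ?_⟩,
    fun c => ⟨fun z => ket (b c) fun j => z (Fin.natAdd _ j), fun z z' h => ?_, fun z => rfl⟩⟩
  · rw [norm_tens, norm_normalizedPairs, norm_ket, one_mul]
  · exact (norm_tens _ _).trans (by rw [norm_normalizedPairs, norm_ket, one_mul])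
  · have : inner ℂ (ket (b c)) (ket (b c')) = 0 := by
      rw [ket, EuclideanSpace.inner_single_left, map_one, one_mul]
      exact (ket_apply _ _).trans (if_neg (b.injective.ne h))
    exact (inner_tens _ _ _ _).trans (by rw [this, mul_zero])
  · refine congrArg _ (funext fun j => h _ ?_)
    simp

/-- The acceptance probability of the tester on a product state. -/
theorem acceptProb_tester_product {G : GateSet} {C : Circuit G (1 + (2 + 2))} {δ : ℝ}
    (hC : ∀ u v : State 2, ‖u‖ = 1 → ‖v‖ = 1 → δ ≤ C.acceptProb (tens ketOne (tens u v)))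
    {n : ℕ} (hn : 2 + 2 ≤ n) (φ : Qustring n) (σ : Equiv.Perm (Fin n)) (m : Composition n)
    (hm : m.length = n) (h : Achieves σ m φ.1) :
    δ ≤ (tester C n).acceptProb (codedInput n σ m φ) := by
  obtain ⟨a, ha, hφ⟩ := h.exists_eq_prodState hm
  have h0 : ∀ τ : State (2 + 2), τ = prodState (fun i => a (Fin.castLE hn i)) → ‖τ‖ = 1 →
      (tester C n).acceptProb (codedInput n σ m φ) = C.acceptProb (tens ketOne τ) := by
    rintro τ rfl hτ
    refine acceptProb_tester C hn φ σ m _ hτ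
      -- The remaining qubits of the product state contribute the factors with index at least 4.
      (fun z => ∏ i with 4 ≤ (i : Fin n).val, a i (z i)) (fun z z' hz => ?_) fun z => ?_
    · refine Finset.prod_congr rfl fun i hi => ?_
      rw [hz i (Finset.mem_filter.1 hi).2]
    · obtain ⟨k, rfl⟩ := Nat.exists_eq_add_of_le hn
      rw [hφ]
      simp only [prodState, Finset.prod_filter]
      rw [Fin.prod_univ_add, Fin.prod_univ_add (fun i => if 4 ≤ (i : Fin (2 + 2 + k)).val then
        a i (z i) else 1)]
      have h1 : ∀ i : Fin (2 + 2), ¬ 4 ≤ (i : ℕ) := fun i => by omega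
      simp only [Fin.val_castAdd, h1, if_false, Finset.prod_const_one, one_mul]
      refine congrArg₂ (· * ·) rfl (Finset.prod_congr rfl fun i _ => ?_)
      rw [if_pos (by simp)]
  have hu : ‖prodState fun i : Fin 2 => a (Fin.castLE hn (Fin.castAdd 2 i))‖ = 1 :=
    norm_prodState fun i => ha _
  have hv : ‖prodState fun i : Fin 2 => a (Fin.castLE hn (Fin.natAdd 2 i))‖ = 1 :=
    norm_prodState fun i => ha _
  rw [h0 _ (prodState_add _).symm (by rw [norm_tens, hu, hv, one_mul])]
  exact hC _ _ hu hv

end Ensemble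

end QEnt

end

theorem mainTheorem6 (G : QEnt.GateSet) (hU : G.Universal) (hI : G.HasIdentity) (hN : G.HasNot) :
    ∃ Ξ : ∀ n : ℕ, QEnt.Qustring n,
      QEnt.IsEntanglementEnsemble (fun n => n) Ξ ∧
      (∃ s : ℕ → ℕ, QEnt.PolyBounded s ∧
        QEnt.UniformlyDistinguishable G (ℓ := fun n => n) (fun n => n)
          (fun _ => 1 / Real.sqrt 2) s Ξ) ∧
      ¬ ∃ s : ℕ → ℕ, QEnt.PolyBounded s ∧
        QEnt.UniformlyApproximable G (ℓ := fun n => n) (fun _ => 1 / Real.sqrt 2) s Ξ := by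
  have hsqrt : 1 / Real.sqrt 2 ≤ 71 / 100 := by
    have : (1.41 : ℝ) ≤ Real.sqrt 2 := Real.le_sqrt_of_sq_le (by norm_num)
    rw [div_le_iff₀ (by positivity)]
    linarith
  have hξ : ∀ n, ∃ ξ : Fin 4 → QEnt.Qustring n, (2 ≤ n → ∀ c, QEnt.SwapBreaks (ξ c).1) ∧
      (6 ≤ n → Orthonormal ℂ fun c => (ξ c).1) ∧
      ∀ hn : 6 ≤ n, ∀ c, QEnt.StartsWithPairs (show 2 + 2 ≤ n by omega) (ξ c).1 := by
    intro n
    by_cases h6 : 6 ≤ n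
    · obtain ⟨ξ, ho, hs⟩ := QEnt.exists_orthonormal_startsWithPairs h6
      exact ⟨ξ, fun _ c => (hs c).swapBreaks (ho.ne_zero c), fun _ => ho, fun _ => hs⟩
    · by_cases h2 : 2 ≤ n
      -- For `2 ≤ n < 6` only partial entanglement matters, since the other requirements are
      -- asymptotic.
      · obtain ⟨φ, hφ⟩ := QEnt.exists_swapBreaks h2
        exact ⟨fun _ => φ, fun _ _ => hφ, fun h => absurd h h6, fun h => absurd h h6⟩
      · exact ⟨fun _ => ⟨QEnt.ket fun _ => false, QEnt.norm_ket _⟩, fun h => absurd h h2,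
          fun h => absurd h h6, fun h => absurd h h6⟩
  choose ξ hswap horth hpairs using hξ
  obtain ⟨c, hc⟩ := QEnt.exists_not_uniformlyApproximable G ξ 6 horth
    (hsqrt.trans_lt (by norm_num))
  obtain ⟨C, hC₁, hC₂⟩ := QEnt.exists_pairs_test hU
  refine ⟨fun n => ξ n (c n), ⟨strictMono_id, fun n hn => (hswap n hn _).partiallyEntangled⟩,
    -- The testers all have the gates of one fixed circuit, so their size is constant and degree 0
    -- suffices.
    ⟨fun _ => C.size, ⟨0, ?_⟩, QEnt.tester C, QEnt.pUniform_tester C, fun n => ?_, ?_⟩, ?_⟩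
  · simpa using Asymptotics.isBigO_const_const (C.size : ℝ) (one_ne_zero (α := ℝ)) Filter.atTop
  · simp [QEnt.Circuit.size, QEnt.tester]
  · filter_upwards [Filter.eventually_ge_atTop 6] with n hn φ σ m hm hach
    obtain ⟨r, hr, hφ⟩ := hpairs n hn (c n)
    have h1 := QEnt.acceptProb_tester C (by omega) (ξ n (c n)) σ m _ QEnt.norm_normalizedPairs
      r hr hφ
    have h2 := hC₁ _ QEnt.norm_normalizedPairs QEnt.norm_pairsCoeff_normalizedPairs
    have h3 := QEnt.acceptProb_tester_product hC₂ (show 2 + 2 ≤ n by omega) φ σ m hm hach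
    rw [← h1] at h2
    rw [abs_sub_comm]
    refine hsqrt.trans (le_trans ?_ (le_abs_self _))
    -- The gap is at least `73/100 - 1/10000`, which exceeds `71/100`.
    linarith
  · rintro ⟨s, -, h⟩
    exact hc s h
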